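/- **Conventions.** An operator space (o.s.) is a closed linear subspace of $B(H)$, $H$ a complex Hilbert space; $M_n(V)\subset M_n(B(H))=B(H^{\oplus n})$, $\|f\|_{cb}=\sup_n\|id_{M_n}\otimes f:M_n(V)\to M_n(W)\|$, and $f$ is completely isometric if all the maps $id_{M_n}\otimes f$ are isometric. For an injective linear map $f:V\to W$ put $D(f)=\|f\|_{cb}\,\|f^{-1}|_{f(V)}\|_{cb}$ (and $D(f)=1$ if $V=\{0\}$); for $\varepsilon>0$, $f$ is a complete $\varepsilon$-embedding if it is injective and $\max\{\|f\|_{cb},\|f^{-1}|_{f(V)}\|_{cb}\}\le 1+\varepsilon$. Let $d_{cb}(V,W)=\inf D(w)$ over all linear isomorphisms $w:V\to W$. Let $\mathcal E$ be a class of finite dimensional (f.d.) o.s., stable under completely isometric isomorphism and containing a nonzero space. * $\mathcal E$ is a *Gurarii class* if for all $L,E\in\mathcal E$, $S\subset L$, injective $u:S\to E$ and $\delta>0$ there are $E_1\in\mathcal E$, a completely isometric $\varphi:E\to E_1$ and an injective $\tilde u:L\to E_1$ with $\tilde u|_S=\varphi u$ and $D(\tilde u)\le(1+\delta)D(u)$.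 * A Gurarii class $\mathcal E$ is *perturbative with associated function* $\delta:(0,\infty)\to(0,\infty)$ if $\lim_{\varepsilon\to0}\delta(\varepsilon)=0$ and for all $\varepsilon>0$, $L,E\in\mathcal E$, $S\subset L$, every complete $\varepsilon$-embedding $u:S\to E$ and every $\delta'>0$ there are $\hat E_1\in\mathcal E$ and complete $\delta'$-embeddings $\varphi:E\to\hat E_1$, $\tilde u:L\to\hat E_1$ with $\|\tilde u|_S-\varphi u\|_{cb}\le\delta(\varepsilon)$. * An o.s. $X$ is an *$\mathcal E$-Gurarii space* if it is separable; for all $\varepsilon>0$, $L\in\mathcal E$, $S\subset L$, every injective $u:S\to X$ extends to an injective $\tilde u:L\to X$ with $D(\tilde u)\le(1+\varepsilon)D(u)$; and for every f.d. $F\subset X$ and $\varepsilon>0$ there are $L\in\mathcal E$ and $\hat F\subset L$ with $d_{cb}(F,\hat F)\le1+\varepsilon$. **Theorem.** Let $\mathcal E$ be a perturbative Gurarii class with associated function $\delta$, and let $X,Y$ be $\mathcal E$-Gurarii spaces. 1. Let $\varepsilon>0$, let $E\subset X$ be a f.d. subspace with $E\in\mathcal E$ and let $u:E\to Y$ be a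 complete $\varepsilon$-embedding. (a) For all $\eta>\varepsilon$ and $\delta'>0$ there is a completely isometric isomorphism $f:X\to Y$ with $\|f|_E-u\|_{cb}\le8\delta(\eta)+\delta'$. (b) For all $\delta'>0$ there is a completely isometric isomorphism $f:X\to Y$ with $\|f|_E-u\|_{cb}\le8\delta(\varepsilon)+\delta'$, provided that at least one of the following holds: $\delta$ is upper semicontinuous from the right at $\varepsilon$ (for instance continuous, as $\delta(\varepsilon)=\varepsilon$); or $u(E)$ is completely isometric to a subspace of a member of $\mathcal E$; or $\|u\|_{cb}\|u^{-1}|_{u(E)}\|_{cb}<(1+\varepsilon)^2$. 2. $X$ and $Y$ are completely isometrically isomorphic. -/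

import Mathlib

open scoped ENNReal Topology

universe u

noncomputable section

namespace OpSpace

section Basic

variable {H : Type u} [NormedAddCommGroup H] [InnerProductSpace ℂ H]
variable {K : Type u} [NormedAddCommGroup K] [InnerProductSpace ℂ K]
variable {K₂ : Type u} [NormedAddCommGroup K₂] [InnerProductSpace ℂ K₂]

/-- The operator on the Hilbert sum `H ⊕ ⋯ ⊕ H` (`n` copies) given by an `n × n` matrix of
operators on `H`: `(A ξ) i = ∑ j, a i j (ξ j)`. This is the identification of `M_n(B(H))` with
`B(H ⊕ ⋯ ⊕ H)`. -/
def matrixOp {n : ℕ} (a : Matrix (Fin n) (Fin n) (H →L[ℂ] H)) :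
    PiLp 2 (fun _ : Fin n => H) →L[ℂ] PiLp 2 (fun _ : Fin n => H) :=
  ((PiLp.continuousLinearEquiv 2 ℂ (fun _ : Fin n => H)).symm :
      (Fin n → H) →L[ℂ] PiLp 2 (fun _ : Fin n => H)) ∘L
    ContinuousLinearMap.pi (fun i => ∑ j, a i j ∘L PiLp.proj 2 (fun _ : Fin n => H) j)

theorem matrixOp_apply {n : ℕ} (a : Matrix (Fin n) (Fin n) (H →L[ℂ] H))
    (ξ : PiLp 2 (fun _ : Fin n => H)) (i : Fin n) :
    matrixOp a ξ i = ∑ j, a i j (ξ j) := by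
  simp [matrixOp]

/-- The norm of `M_n(V)` for a subspace `V` of `B(H)`, inherited from `M_n(B(H))`. -/
def matNorm {n : ℕ} {V : Submodule ℂ (H →L[ℂ] H)} (a : Matrix (Fin n) (Fin n) V) : ℝ≥0∞ :=
  ‖matrixOp (a.map (fun x => (x : H →L[ℂ] H)))‖ₑ

/-- The completely bounded norm `‖f‖_cb = sup_n ‖id_{M_n} ⊗ f : M_n(V) → M_n(W)‖`
(equal to `∞` when `f` is not completely bounded). -/
def cbNorm {V : Submodule ℂ (H →L[ℂ] H)} {W : Submodule ℂ (K →L[ℂ] K)} (f : V →ₗ[ℂ] W) :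
    ℝ≥0∞ :=
  ⨆ (n : ℕ) (a : Matrix (Fin n) (Fin n) V) (_ : matNorm a ≤ 1), matNorm (a.map f)

/-- The range of a map `f : V → W ⊆ B(K)`, as a subspace of `B(K)`. -/
def rangeIn {V : Submodule ℂ (H →L[ℂ] H)} {W : Submodule ℂ (K →L[ℂ] K)} (f : V →ₗ[ℂ] W) :
    Submodule ℂ (K →L[ℂ] K) :=
  LinearMap.range (W.subtype ∘ₗ f)

/-- The inverse `f⁻¹ : f(V) → V` of an injective map `f : V → W`. -/
def inverseOnRange {V : Submodule ℂ (H →L[ℂ] H)} {W : Submodule ℂ (K →L[ℂ] K)} (f : V →ₗ[ℂ] W)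
    (hf : Function.Injective f) : rangeIn f →ₗ[ℂ] V :=
  (LinearEquiv.ofInjective (W.subtype ∘ₗ f) (W.injective_subtype.comp hf)).symm.toLinearMap

open Classical in
/-- `‖f⁻¹ : f(V) → V‖_cb` for an injective map `f` (and `∞` if `f` is not injective). -/
def invCbNorm {V : Submodule ℂ (H →L[ℂ] H)} {W : Submodule ℂ (K →L[ℂ] K)} (f : V →ₗ[ℂ] W) :
    ℝ≥0∞ :=
  if hf : Function.Injective f then cbNorm (inverseOnRange f hf) else ∞

/-- The distortion `D(f) = ‖f‖_cb ‖f⁻¹|_{f(V)}‖_cb` of an injective map. The product is at least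
`1` if `V ≠ 0`; the maximum only serves to give the distortion `1` to the zero map
on `V = 0`. -/
def distortion {V : Submodule ℂ (H →L[ℂ] H)} {W : Submodule ℂ (K →L[ℂ] K)} (f : V →ₗ[ℂ] W) :
    ℝ≥0∞ :=
  max 1 (cbNorm f * invCbNorm f)

/-- `f` is a (complete) `ε`-embedding: it is injective and
`max {‖f‖_cb, ‖f⁻¹|_{f(V)}‖_cb} ≤ 1 + ε`. -/
def IsEpsEmbedding {V : Submodule ℂ (H →L[ℂ] H)} {W : Submodule ℂ (K →L[ℂ] K)} (ε : ℝ)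
    (f : V →ₗ[ℂ] W) : Prop :=
  Function.Injective f ∧ cbNorm f ≤ ENNReal.ofReal (1 + ε) ∧
    invCbNorm f ≤ ENNReal.ofReal (1 + ε)

/-- `f` is completely isometric: all the maps `M_n(V) → M_n(W)` that it induces are isometric. -/
def IsCompletelyIsometric {V : Submodule ℂ (H →L[ℂ] H)} {W : Submodule ℂ (K →L[ℂ] K)}
    (f : V →ₗ[ℂ] W) : Prop :=
  ∀ (n : ℕ) (a : Matrix (Fin n) (Fin n) V), matNorm (a.map f) = matNorm a

/-- The completely bounded Banach-Mazur distance
`d_cb(V, W) = inf {‖w‖_cb ‖w⁻¹‖_cb | w : V → W a linear isomorphism}`. -/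
def dcb (V : Submodule ℂ (H →L[ℂ] H)) (W : Submodule ℂ (K →L[ℂ] K)) : ℝ≥0∞ :=
  ⨅ w : V ≃ₗ[ℂ] W, distortion (w : V →ₗ[ℂ] W)

end Basic

/-- A finite dimensional operator space: a finite dimensional subspace of `B(H)` for some complex
Hilbert space `H`. -/
structure FDOpSpace : Type (u + 1) where
  /-- the Hilbert space -/
  H : Type u
  [normed : NormedAddCommGroup H]
  [inner : InnerProductSpace ℂ H]
  [complete : CompleteSpace H]
  /-- the subspace of `B(H)` -/
  carrier : Submodule ℂ (H →L[ℂ] H)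
  [finDim : FiniteDimensional ℂ carrier]

attribute [instance] FDOpSpace.normed FDOpSpace.inner FDOpSpace.complete FDOpSpace.finDim

/-- The standing assumptions on a class of finite dimensional operator spaces: it contains, with
any space, all the spaces that are completely isometrically isomorphic to it, and it
contains a nonzero space. -/
structure IsClass (𝓔 : Set FDOpSpace.{u}) : Prop where
  stable : ∀ E ∈ 𝓔, ∀ (F : FDOpSpace.{u}) (w : E.carrier ≃ₗ[ℂ] F.carrier),
    IsCompletelyIsometric (w : E.carrier →ₗ[ℂ] F.carrier) → F ∈ 𝓔
  nontrivial : ∃ E ∈ 𝓔, Nontrivial E.carrier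

/-- `𝓔` is a Gurarii class: any injective map `f : S → E`, with `S ⊆ L` and `L, E ∈ 𝓔`, extends,
for any `δ > 0`, to a map `g : L → E₁` with `D(g) ≤ (1 + δ) D(f)` where `E₁ ∈ 𝓔` contains `E`
completely isometrically through `φ`. -/
def IsGurariiClass (𝓔 : Set FDOpSpace.{u}) : Prop :=
  ∀ L ∈ 𝓔, ∀ E ∈ 𝓔, ∀ (S : Submodule ℂ (L.H →L[ℂ] L.H)) (hS : S ≤ L.carrier)
    (f : S →ₗ[ℂ] E.carrier), Function.Injective f → ∀ δ : ℝ, 0 < δ →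
    ∃ E₁ ∈ 𝓔, ∃ (φ : E.carrier →ₗ[ℂ] E₁.carrier) (g : L.carrier →ₗ[ℂ] E₁.carrier),
      IsCompletelyIsometric φ ∧ Function.Injective g ∧
      g ∘ₗ Submodule.inclusion hS = φ ∘ₗ f ∧
      distortion g ≤ ENNReal.ofReal (1 + δ) * distortion f

/-- `δ : (0, ∞) → (0, ∞)`, with `δ(ε) → 0` when `ε → 0`, is a function for which `𝓔` has the
perturbation property: for any `ε > 0`, any `ε`-embedding `f : S → E` with `S ⊆ L` and
`L, E ∈ 𝓔`, and any `δ' > 0`, there are `δ'`-embeddings `φ : E → E₁` and `g : L → E₁` with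
`E₁ ∈ 𝓔` such that `‖g|_S - φ f‖_cb ≤ δ(ε)`. -/
structure IsPerturbationFunction (𝓔 : Set FDOpSpace.{u}) (δ : ℝ → ℝ) : Prop where
  pos : ∀ ε : ℝ, 0 < ε → 0 < δ ε
  tendsto : Filter.Tendsto δ (𝓝[>] 0) (𝓝 0)
  perturb : ∀ ε : ℝ, 0 < ε → ∀ L ∈ 𝓔, ∀ E ∈ 𝓔, ∀ (S : Submodule ℂ (L.H →L[ℂ] L.H))
    (hS : S ≤ L.carrier) (f : S →ₗ[ℂ] E.carrier), IsEpsEmbedding ε f →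
    ∀ δ' : ℝ, 0 < δ' →
    ∃ E₁ ∈ 𝓔, ∃ (φ : E.carrier →ₗ[ℂ] E₁.carrier) (g : L.carrier →ₗ[ℂ] E₁.carrier),
      IsEpsEmbedding δ' φ ∧ IsEpsEmbedding δ' g ∧
      cbNorm (g ∘ₗ Submodule.inclusion hS - φ ∘ₗ f) ≤ ENNReal.ofReal (δ ε)

/-- `𝓔` is a perturbative Gurarii class, with associated function `δ`. -/
structure IsPerturbativeGurariiClass (𝓔 : Set FDOpSpace.{u}) (δ : ℝ → ℝ) : Prop where
  isClass : IsClass 𝓔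
  gurarii : IsGurariiClass 𝓔
  perturbative : IsPerturbationFunction 𝓔 δ

section Spaces

variable {H : Type u} [NormedAddCommGroup H] [InnerProductSpace ℂ H]

/-- `F` is completely isometric to a subspace of a space in `𝓔`. -/
def IsSubspaceOfMember (𝓔 : Set FDOpSpace.{u}) (F : Submodule ℂ (H →L[ℂ] H)) : Prop :=
  ∃ L ∈ 𝓔, ∃ j : F →ₗ[ℂ] L.carrier, IsCompletelyIsometric j

/-- `X` has the `𝓔`-Gurarii property: any injective map `f : S → X` with `S ⊆ L ∈ 𝓔` extends, for
any `ε > 0`, to an injective map `g : L → X` with `D(g) ≤ (1 + ε) D(f)`. -/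
def HasGurariiProperty (𝓔 : Set FDOpSpace.{u}) (X : Submodule ℂ (H →L[ℂ] H)) : Prop :=
  ∀ ε : ℝ, 0 < ε → ∀ L ∈ 𝓔, ∀ (S : Submodule ℂ (L.H →L[ℂ] L.H)) (hS : S ≤ L.carrier)
    (f : S →ₗ[ℂ] X), Function.Injective f →
    ∃ g : L.carrier →ₗ[ℂ] X, Function.Injective g ∧ g ∘ₗ Submodule.inclusion hS = f ∧
      distortion g ≤ ENNReal.ofReal (1 + ε) * distortion f

/-- `X` locally embeds in `𝓔`: for any finite dimensional `F ⊆ X` and any `ε > 0` there are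
`L ∈ 𝓔` and a subspace `G ⊆ L` with `d_cb(F, G) ≤ 1 + ε`. -/
def LocallyEmbeds (𝓔 : Set FDOpSpace.{u}) (X : Submodule ℂ (H →L[ℂ] H)) : Prop :=
  ∀ F : Submodule ℂ (H →L[ℂ] H), FiniteDimensional ℂ F → F ≤ X → ∀ ε : ℝ, 0 < ε →
    ∃ L ∈ 𝓔, ∃ G : Submodule ℂ (L.H →L[ℂ] L.H), G ≤ L.carrier ∧
      dcb F G ≤ ENNReal.ofReal (1 + ε)

/-- `X ⊆ B(H)` is an `𝓔`-Gurarii space: a separable operator space (that is, a closed subspace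
of `B(H)`) that has the `𝓔`-Gurarii property and locally embeds in `𝓔`. -/
structure IsGurariiSpace (𝓔 : Set FDOpSpace.{u}) (X : Submodule ℂ (H →L[ℂ] H)) : Prop where
  closed : IsClosed (X : Set (H →L[ℂ] H))
  separable : TopologicalSpace.IsSeparable (X : Set (H →L[ℂ] H))
  gurarii : HasGurariiProperty 𝓔 X
  locallyEmbeds : LocallyEmbeds 𝓔 X

end Spaces

end OpSpace

end

/-! The proof is an approximate back-and-forth. A stage is a member `L` of the class with maps `a :
L → X` and `b : L → Y` whose cb norms, and those of their inverses, are at most a constant `κ m`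
close to `1`; it stands for the partial map `b a⁻¹`.

To absorb a point `x` of `X`, embed `a(L) + ℂx` almost isometrically in a member `L'` and use the
Gurarii property of `X` and of `Y` to factor `a` through `a' : L' → X` and `b` through `b₀ : L' →
Y`. The constants of `b₀` are no better than those of `b`, so iterating this alone would never
converge. The perturbation property cures it (`IsPerturbationFunction.exists_near`): `b₀` is close
to a map `b'` with constants as near to `1` as desired, and the displacement is governed only by the
quality of `b₀`. A tolerance `τ` therefore fixes the quality required of the current stage, while
the quality of the next one is free (`exists_enlargement`).

With tolerances decreasing geometrically, the graphs of the partial maps have a limit subspace of `X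
× Y`. Constants tending to `1` give equal matrix norms to corresponding matrices, and asymptotic
density makes the limit the graph of a complete isometry of `X` onto `Y`
(`exists_isometry_of_sequence`). It stays close to the initial stage in norm, hence in cb norm,
since on a finite dimensional domain the two are equivalent with a constant independent of the
target (`exists_cbLE_of_norm_le`).

For a given `u : E → Y`, one more perturbation first replaces `u` by an almost isometric map within
about `δ η`. The cases of the theorem differ only in how an almost isometric copy of `u(E)` in a
member is found for which the composite with `u` is an `η`-embedding. This argument needs only one
`δ η`, so the factor `8` leaves room. -/

noncomputable section

namespace OpSpace

/-! ### Matrix norms over an operator space. -/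

section MatrixNorm

variable {H : Type u} [NormedAddCommGroup H] [InnerProductSpace ℂ H]
variable {K : Type u} [NormedAddCommGroup K] [InnerProductSpace ℂ K]

theorem opNorm_smul_eq {E : Type*} [NormedAddCommGroup E] [NormedSpace ℂ E] (c : ℂ)
    (T : E →L[ℂ] E) : ‖c • T‖ = ‖c‖ * ‖T‖ :=
  norm_smul c T

theorem matrixOp_add {n : ℕ} (a b : Matrix (Fin n) (Fin n) (H →L[ℂ] H)) :
    matrixOp (a + b) = matrixOp a + matrixOp b := by
  ext ξ i
  simp [matrixOp_apply, Finset.sum_add_distrib]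

theorem matrixOp_smul {n : ℕ} (c : ℂ) (a : Matrix (Fin n) (Fin n) (H →L[ℂ] H)) :
    matrixOp (c • a) = c • matrixOp a := by
  ext ξ i
  simp [matrixOp_apply, Finset.smul_sum]

theorem norm_entry_le {n : ℕ} (a : Matrix (Fin n) (Fin n) (H →L[ℂ] H)) (i j : Fin n) :
    ‖a i j‖ ≤ ‖matrixOp a‖ := by
  refine ContinuousLinearMap.opNorm_le_bound _ (ContinuousLinearMap.opNorm_nonneg _) fun x => ?_
  set ξ : PiLp 2 (fun _ : Fin n => H) := PiLp.single 2 j x with hξ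
  have hn : ‖ξ‖ = ‖x‖ := by simp [hξ]
  have h1 : matrixOp a ξ i = a i j x := by
    rw [matrixOp_apply, Finset.sum_eq_single j]
    · simp [hξ]
    · intro b _ hb
      simp [hξ, hb]
    · simp
  rw [← h1, ← hn]
  exact (PiLp.norm_apply_le _ _).trans (ContinuousLinearMap.le_opNorm _ _)

theorem norm_matrixOp_le_sum {n : ℕ} (a : Matrix (Fin n) (Fin n) (H →L[ℂ] H)) :
    ‖matrixOp a‖ ≤ ∑ i, ∑ j, ‖a i j‖ := by
  refine ContinuousLinearMap.opNorm_le_bound _ (by positivity) fun ξ => ?_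
  have h0 : ∀ η : PiLp 2 (fun _ : Fin n => H), ‖η‖ ≤ ∑ i, ‖η i‖ := by
    intro η
    rw [PiLp.norm_eq_of_L2]
    refine Real.sqrt_le_iff.2 ⟨by positivity, ?_⟩
    exact Finset.sum_sq_le_sq_sum_of_nonneg fun i _ => norm_nonneg _
  refine (h0 _).trans ?_
  rw [Finset.sum_mul]
  refine Finset.sum_le_sum fun i _ => ?_
  rw [matrixOp_apply, Finset.sum_mul]
  refine (norm_sum_le _ _).trans (Finset.sum_le_sum fun j _ => ?_)
  refine ((a i j).le_opNorm _).trans ?_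
  gcongr
  exact PiLp.norm_apply_le _ _

variable {V : Submodule ℂ (H →L[ℂ] H)} {W : Submodule ℂ (K →L[ℂ] K)}

/-- The norm of `M_n(V)` as a real number. -/
def mnorm {n : ℕ} (a : Matrix (Fin n) (Fin n) V) : ℝ :=
  ‖matrixOp (a.map (fun x => (x : H →L[ℂ] H)))‖

theorem matNorm_eq_ofReal {n : ℕ} (a : Matrix (Fin n) (Fin n) V) :
    matNorm a = ENNReal.ofReal (mnorm a) :=
  (ofReal_norm _).symm

theorem mnorm_nonneg {n : ℕ} (a : Matrix (Fin n) (Fin n) V) : 0 ≤ mnorm a :=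
  ContinuousLinearMap.opNorm_nonneg _

theorem mnorm_add_le {n : ℕ} (a b : Matrix (Fin n) (Fin n) V) :
    mnorm (a + b) ≤ mnorm a + mnorm b := by
  have h : (a + b).map (fun x => (x : H →L[ℂ] H)) =
      a.map (fun x => (x : H →L[ℂ] H)) + b.map (fun x => (x : H →L[ℂ] H)) := by
    ext i j; simp
  unfold mnorm
  rw [h, matrixOp_add]
  exact ContinuousLinearMap.opNorm_add_le _ _

theorem mnorm_smul {n : ℕ} (c : ℂ) (a : Matrix (Fin n) (Fin n) V) :
    mnorm (c • a) = ‖c‖ * mnorm a := by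
  have h : (c • a).map (fun x => (x : H →L[ℂ] H)) =
      c • a.map (fun x => (x : H →L[ℂ] H)) := by
    ext i j; simp
  unfold mnorm
  rw [h, matrixOp_smul]
  exact opNorm_smul_eq c _

theorem mnorm_le_sum {n : ℕ} (a : Matrix (Fin n) (Fin n) V) :
    mnorm a ≤ ∑ i, ∑ j, ‖a i j‖ :=
  norm_matrixOp_le_sum _

theorem norm_entry_le_mnorm {n : ℕ} (a : Matrix (Fin n) (Fin n) V) (i j : Fin n) :
    ‖a i j‖ ≤ mnorm a :=
  norm_entry_le (a.map (fun x => (x : H →L[ℂ] H))) i j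

theorem mnorm_one (x : V) : mnorm (fun _ _ => x : Matrix (Fin 1) (Fin 1) V) = ‖x‖ := by
  refine le_antisymm ?_ (norm_entry_le_mnorm (fun _ _ => x : Matrix (Fin 1) (Fin 1) V) 0 0)
  simpa using mnorm_le_sum (fun _ _ => x : Matrix (Fin 1) (Fin 1) V)

theorem mnorm_sum_le {n : ℕ} {ι : Type*} (s : Finset ι) (a : ι → Matrix (Fin n) (Fin n) V) :
    mnorm (∑ k ∈ s, a k) ≤ ∑ k ∈ s, mnorm (a k) := by
  classical
  induction s using Finset.induction_on with
  | empty => simpa using mnorm_le_sum (0 : Matrix (Fin n) (Fin n) V)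
  | insert k s hk ih =>
    rw [Finset.sum_insert hk, Finset.sum_insert hk]
    exact (mnorm_add_le _ _).trans (by gcongr)

theorem mnorm_eq_zero {n : ℕ} {a : Matrix (Fin n) (Fin n) V} (h : mnorm a = 0) : a = 0 := by
  ext1 i j
  exact norm_le_zero_iff.1 ((norm_entry_le_mnorm a i j).trans h.le)

/-- Lets entrywise approximation control matrix norms. The factor `n * n` is harmless because limits
are taken at a fixed matrix size. -/
theorem mnorm_le_add_of_forall_norm_sub_le {n : ℕ} (a b : Matrix (Fin n) (Fin n) V) {θ : ℝ}
    (h : ∀ i j, ‖a i j - b i j‖ ≤ θ) : mnorm a ≤ mnorm b + n * n * θ := by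
  have h1 : mnorm a ≤ mnorm b + mnorm (a - b) := by
    simpa using mnorm_add_le b (a - b)
  have h2 : mnorm (a - b) ≤ n * n * θ := by
    refine (mnorm_le_sum _).trans ?_
    refine (Finset.sum_le_sum fun i _ => Finset.sum_le_sum fun j _ => h i j).trans ?_
    simp [mul_assoc]
  linarith

end MatrixNorm

/-! ### Real-valued two-sided cb bounds. -/

section CbBounds

variable {H : Type u} [NormedAddCommGroup H] [InnerProductSpace ℂ H]
variable {K : Type u} [NormedAddCommGroup K] [InnerProductSpace ℂ K]
variable {K₂ : Type u} [NormedAddCommGroup K₂] [InnerProductSpace ℂ K₂]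
variable {V : Submodule ℂ (H →L[ℂ] H)} {W : Submodule ℂ (K →L[ℂ] K)}
variable {U : Submodule ℂ (K₂ →L[ℂ] K₂)}

/-- `‖f‖_cb ≤ c`. -/
def CbLE (f : V →ₗ[ℂ] W) (c : ℝ) : Prop :=
  ∀ (n : ℕ) (a : Matrix (Fin n) (Fin n) V), mnorm (a.map f) ≤ c * mnorm a

/-- `‖f⁻¹‖_cb ≤ d` on the range of `f`. -/
def CbGE (f : V →ₗ[ℂ] W) (d : ℝ) : Prop :=
  ∀ (n : ℕ) (a : Matrix (Fin n) (Fin n) V), mnorm a ≤ d * mnorm (a.map f)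

theorem CbLE.norm_le {f : V →ₗ[ℂ] W} {c : ℝ} (h : CbLE f c) (x : V) : ‖f x‖ ≤ c * ‖x‖ := by
  have := h 1 (fun _ _ => x)
  rw [mnorm_one] at this
  exact (mnorm_one (f x)) ▸ this

theorem CbGE.norm_le {f : V →ₗ[ℂ] W} {c : ℝ} (h : CbGE f c) (x : V) : ‖x‖ ≤ c * ‖f x‖ := by
  have := h 1 (fun _ _ => x)
  rw [mnorm_one] at this
  exact (mnorm_one (f x)) ▸ this

theorem CbGE.injective {f : V →ₗ[ℂ] W} {c : ℝ} (h : CbGE f c) : Function.Injective f := by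
  refine (injective_iff_map_eq_zero f).2 fun x hx => ?_
  have := h.norm_le x
  have h0 : ‖f x‖ = 0 := by rw [hx]; exact norm_zero
  rw [h0, mul_zero] at this
  exact norm_le_zero_iff.1 this

theorem CbLE.mono {f : V →ₗ[ℂ] W} {c c' : ℝ} (h : CbLE f c) (hc : c ≤ c') : CbLE f c' :=
  fun n a => (h n a).trans (mul_le_mul_of_nonneg_right hc (mnorm_nonneg _))

theorem CbGE.mono {f : V →ₗ[ℂ] W} {c c' : ℝ} (h : CbGE f c) (hc : c ≤ c') : CbGE f c' :=
  fun n a => (h n a).trans (mul_le_mul_of_nonneg_right hc (mnorm_nonneg _))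

theorem CbLE.comp {g : W →ₗ[ℂ] U} {f : V →ₗ[ℂ] W} {c d : ℝ} (hg : CbLE g d) (hf : CbLE f c)
    (hd : 0 ≤ d) : CbLE (g ∘ₗ f) (d * c) := fun n a => by
  have h1 := hg n (a.map f)
  have h2 := mul_le_mul_of_nonneg_left (hf n a) hd
  rw [Matrix.map_map] at h1
  rw [mul_assoc]
  exact h1.trans h2

theorem CbGE.comp {g : W →ₗ[ℂ] U} {f : V →ₗ[ℂ] W} {c d : ℝ} (hg : CbGE g d) (hf : CbGE f c)
    (hc : 0 ≤ c) : CbGE (g ∘ₗ f) (d * c) := fun n a => by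
  have h1 := mul_le_mul_of_nonneg_left (hg n (a.map f)) hc
  rw [Matrix.map_map] at h1
  rw [mul_comm d, mul_assoc]
  exact (hf n a).trans h1

theorem CbLE.add {f g : V →ₗ[ℂ] W} {c d : ℝ} (hf : CbLE f c) (hg : CbLE g d) :
    CbLE (f + g) (c + d) := fun n a => by
  have h : a.map (⇑(f + g)) = a.map f + a.map g := by ext1 i j; simp
  rw [h, add_mul]
  exact (mnorm_add_le _ _).trans (add_le_add (hf n a) (hg n a))

theorem map_smul_linearMap {n : ℕ} (s : ℂ) (f : V →ₗ[ℂ] W) (a : Matrix (Fin n) (Fin n) V) :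
    a.map (⇑(s • f)) = s • a.map f := by
  ext1 i j; simp

theorem CbLE.smul {f : V →ₗ[ℂ] W} {c s : ℝ} (hf : CbLE f c) (hs : 0 ≤ s) :
    CbLE ((s : ℂ) • f) (s * c) := fun n a => by
  rw [map_smul_linearMap, mnorm_smul, Complex.norm_real, Real.norm_of_nonneg hs, mul_assoc]
  exact mul_le_mul_of_nonneg_left (hf n a) hs

theorem CbGE.smul {f : V →ₗ[ℂ] W} {d s : ℝ} (hf : CbGE f d) (hs : 0 < s) :
    CbGE ((s : ℂ) • f) (s⁻¹ * d) := fun n a => by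
  rw [map_smul_linearMap, mnorm_smul, Complex.norm_real, Real.norm_of_nonneg hs.le]
  refine (hf n a).trans_eq ?_
  field_simp

theorem mnorm_map_inclusion {V' : Submodule ℂ (H →L[ℂ] H)} (h : V ≤ V') {n : ℕ}
    (a : Matrix (Fin n) (Fin n) V) : mnorm (a.map (Submodule.inclusion h)) = mnorm a := rfl

theorem cbLE_of_subsingleton [Subsingleton V] (f : V →ₗ[ℂ] W) (c : ℝ) : CbLE f c := fun n a => by
  have ha : a = 0 := by ext1 i j; exact Subsingleton.elim _ _
  have h1 : mnorm (0 : Matrix (Fin n) (Fin n) V) = 0 := by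
    simpa using mnorm_smul 0 (0 : Matrix (Fin n) (Fin n) V)
  have h2 : mnorm (0 : Matrix (Fin n) (Fin n) W) = 0 := by
    simpa using mnorm_smul 0 (0 : Matrix (Fin n) (Fin n) W)
  have h3 : (0 : Matrix (Fin n) (Fin n) V).map f = 0 := by ext1 i j; simp
  rw [ha, h3, h1, h2, mul_zero]

theorem cbGE_of_subsingleton [Subsingleton V] (f : V →ₗ[ℂ] W) (c : ℝ) : CbGE f c := fun n a => by
  have ha : a = 0 := by ext1 i j; exact Subsingleton.elim _ _
  have h1 : mnorm (0 : Matrix (Fin n) (Fin n) V) = 0 := by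
    simpa using mnorm_smul 0 (0 : Matrix (Fin n) (Fin n) V)
  have h2 : mnorm (0 : Matrix (Fin n) (Fin n) W) = 0 := by
    simpa using mnorm_smul 0 (0 : Matrix (Fin n) (Fin n) W)
  have h3 : (0 : Matrix (Fin n) (Fin n) V).map f = 0 := by ext1 i j; simp
  rw [ha, h3, h1, h2, mul_zero]

/-- Homogeneity: a nonzero matrix is scaled into the unit ball. This is the bridge from suprema in
`ℝ≥0∞` to plain inequalities. -/
theorem cbNorm_le_ofReal_iff {f : V →ₗ[ℂ] W} {c : ℝ} (hc : 0 ≤ c) :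
    cbNorm f ≤ ENNReal.ofReal c ↔ CbLE f c := by
  simp only [cbNorm, iSup_le_iff, matNorm_eq_ofReal]
  constructor
  · intro h n a
    rcases (mnorm_nonneg a).eq_or_lt with h0 | h0
    · have h3 : (0 : Matrix (Fin n) (Fin n) V).map f = 0 := by ext1 i j; simp
      have h2 : mnorm (0 : Matrix (Fin n) (Fin n) W) = 0 := by
        simpa using mnorm_smul 0 (0 : Matrix (Fin n) (Fin n) W)
      rw [mnorm_eq_zero h0.symm, h3, h2]
      exact mul_nonneg hc (mnorm_nonneg _)
    · set s : ℂ := (((mnorm a)⁻¹ : ℝ) : ℂ) with hs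
      have hs' : ‖s‖ = (mnorm a)⁻¹ := by
        rw [hs, Complex.norm_real, Real.norm_of_nonneg (by positivity)]
      have h1 := h n (s • a) (by
        rw [mnorm_smul, hs', inv_mul_cancel₀ h0.ne', ENNReal.ofReal_one])
      have h4 : (s • a).map f = s • a.map f := by ext i j; simp
      rw [h4, mnorm_smul, hs', ENNReal.ofReal_le_ofReal_iff hc, inv_mul_le_iff₀ h0] at h1
      linarith
  · intro h n a ha
    refine ENNReal.ofReal_le_ofReal ?_
    have h1 : mnorm a ≤ 1 := by
      rw [← ENNReal.ofReal_one, ENNReal.ofReal_le_ofReal_iff zero_le_one] at ha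
      exact ha
    exact (h n a).trans (mul_le_of_le_one_right hc h1)

theorem cbLE_toReal {f : V →ₗ[ℂ] W} (h : cbNorm f ≠ ∞) : CbLE f (cbNorm f).toReal :=
  (cbNorm_le_ofReal_iff ENNReal.toReal_nonneg).1 (ENNReal.ofReal_toReal h).ge

/-- A map as a map onto its range. -/
def toRange (f : V →ₗ[ℂ] W) : V →ₗ[ℂ] rangeIn f := (W.subtype ∘ₗ f).rangeRestrict

theorem rangeIn_le (f : V →ₗ[ℂ] W) : rangeIn f ≤ W := by
  rintro _ ⟨x, rfl⟩
  exact (f x).2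

theorem inverseOnRange_toRange (f : V →ₗ[ℂ] W) (hf : Function.Injective f) (x : V) :
    inverseOnRange f hf (toRange f x) = x :=
  (LinearEquiv.ofInjective (W.subtype ∘ₗ f) (W.injective_subtype.comp hf)).symm_apply_apply x

theorem toRange_inverseOnRange (f : V →ₗ[ℂ] W) (hf : Function.Injective f) (y : rangeIn f) :
    toRange f (inverseOnRange f hf y) = y :=
  (LinearEquiv.ofInjective (W.subtype ∘ₗ f) (W.injective_subtype.comp hf)).apply_symm_apply y

theorem mnorm_map_toRange (f : V →ₗ[ℂ] W) {n : ℕ} (a : Matrix (Fin n) (Fin n) V) :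
    mnorm (a.map (toRange f)) = mnorm (a.map f) := rfl

theorem cbLE_inverseOnRange_iff {f : V →ₗ[ℂ] W} (hf : Function.Injective f) {d : ℝ} :
    CbLE (inverseOnRange f hf) d ↔ CbGE f d := by
  constructor
  · intro h n a
    have h1 := h n (a.map (toRange f))
    have h2 : (a.map (toRange f)).map (inverseOnRange f hf) = a := by
      ext1 i j
      exact inverseOnRange_toRange f hf _
    rwa [h2, mnorm_map_toRange] at h1
  · intro h n a
    have h1 := h n (a.map (inverseOnRange f hf))
    have h2 : (a.map (inverseOnRange f hf)).map (toRange f) = a := by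
      ext1 i j
      exact toRange_inverseOnRange f hf _
    rwa [← mnorm_map_toRange f, h2] at h1

theorem cbGE_inverseOnRange {f : V →ₗ[ℂ] W} (hf : Function.Injective f) {c : ℝ}
    (h : CbLE f c) : CbGE (inverseOnRange f hf) c := fun n a => by
  have h1 := h n (a.map (inverseOnRange f hf))
  have h2 : (a.map (inverseOnRange f hf)).map (toRange f) = a := by
    ext1 i j
    exact toRange_inverseOnRange f hf _
  rwa [← mnorm_map_toRange, h2] at h1

theorem invCbNorm_le_ofReal_iff {f : V →ₗ[ℂ] W} {d : ℝ} (hd : 0 ≤ d) :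
    invCbNorm f ≤ ENNReal.ofReal d ↔ CbGE f d := by
  by_cases hf : Function.Injective f
  · rw [invCbNorm, dif_pos hf, cbNorm_le_ofReal_iff hd, cbLE_inverseOnRange_iff]
  · rw [invCbNorm, dif_neg hf]
    exact ⟨fun h => absurd h (by simp), fun h => absurd h.injective hf⟩

theorem cbGE_toReal {f : V →ₗ[ℂ] W} (h : invCbNorm f ≠ ∞) : CbGE f (invCbNorm f).toReal :=
  (invCbNorm_le_ofReal_iff ENNReal.toReal_nonneg).1 (ENNReal.ofReal_toReal h).ge

/-- The bounds `‖f‖_cb ≤ κ` and `‖f⁻¹‖_cb ≤ κ`. -/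
def IsCbEmb (κ : ℝ) (f : V →ₗ[ℂ] W) : Prop := CbLE f κ ∧ CbGE f κ

theorem isEpsEmbedding_iff {f : V →ₗ[ℂ] W} {ε : ℝ} (hε : 0 < ε) :
    IsEpsEmbedding ε f ↔ IsCbEmb (1 + ε) f := by
  rw [IsEpsEmbedding, cbNorm_le_ofReal_iff (by linarith), invCbNorm_le_ofReal_iff (by linarith)]
  exact ⟨fun h => h.2, fun h => ⟨h.2.injective, h⟩⟩

theorem IsCbEmb.mono {f : V →ₗ[ℂ] W} {c c' : ℝ} (h : IsCbEmb c f) (hc : c ≤ c') :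
    IsCbEmb c' f := ⟨h.1.mono hc, h.2.mono hc⟩

theorem IsCbEmb.comp {g : W →ₗ[ℂ] U} {f : V →ₗ[ℂ] W} {c d : ℝ} (hg : IsCbEmb d g)
    (hf : IsCbEmb c f) (hc : 0 ≤ c) (hd : 0 ≤ d) : IsCbEmb (d * c) (g ∘ₗ f) :=
  ⟨hg.1.comp hf.1 hd, hg.2.comp hf.2 hc⟩

theorem isCbEmb_inverseOnRange {f : V →ₗ[ℂ] W} {κ : ℝ} (h : IsCbEmb κ f) :
    IsCbEmb κ (inverseOnRange f h.2.injective) :=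
  ⟨(cbLE_inverseOnRange_iff _).2 h.2, cbGE_inverseOnRange _ h.1⟩

theorem isCbEmb_inclusion {V' : Submodule ℂ (H →L[ℂ] H)} (h : V ≤ V') :
    IsCbEmb 1 (Submodule.inclusion h) :=
  ⟨fun n a => by rw [mnorm_map_inclusion, one_mul],
    fun n a => by rw [mnorm_map_inclusion, one_mul]⟩

theorem IsCompletelyIsometric.isCbEmb {f : V →ₗ[ℂ] W} (h : IsCompletelyIsometric f) :
    IsCbEmb 1 f := by
  have h1 : ∀ (n : ℕ) (a : Matrix (Fin n) (Fin n) V), mnorm (a.map f) = mnorm a := fun n a => by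
    have := h n a
    rwa [matNorm_eq_ofReal, matNorm_eq_ofReal,
      ENNReal.ofReal_eq_ofReal_iff (mnorm_nonneg _) (mnorm_nonneg _)] at this
  exact ⟨fun n a => by rw [h1, one_mul], fun n a => by rw [h1, one_mul]⟩

/-- A bound on the distortion of a map on a nonzero space splits into bounds on the two cb norms. -/
theorem exists_bounds_of_distortion_le [Nontrivial V] {f : V →ₗ[ℂ] W}
    (hf : Function.Injective f) {r : ℝ} (hr : 0 ≤ r) (h : distortion f ≤ ENNReal.ofReal r) :
    ∃ c d : ℝ, 0 < c ∧ 0 < d ∧ d * c ≤ r ∧ CbLE f c ∧ CbGE f d := by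
  have hmul : cbNorm f * invCbNorm f ≤ ENNReal.ofReal r := (le_max_right _ _).trans h
  obtain ⟨x, hx⟩ := exists_ne (0 : V)
  have hx0 : 0 < ‖x‖ := norm_pos_iff.2 hx
  have hfx : 0 < ‖f x‖ := norm_pos_iff.2 fun h0 => hx (hf (h0.trans (map_zero f).symm))
  have hc0 : cbNorm f ≠ 0 := fun h0 => by
    have h1 : CbLE f 0 := (cbNorm_le_ofReal_iff le_rfl).1 (by simp [h0])
    have := h1.norm_le x
    linarith
  have hd0 : invCbNorm f ≠ 0 := fun h0 => by
    have h1 : CbGE f 0 := (invCbNorm_le_ofReal_iff le_rfl).1 (by simp [h0])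
    have := h1.norm_le x
    linarith
  have hlt := hmul.trans_lt ENNReal.ofReal_lt_top
  -- Nonvanishing of each factor excludes `0 * ∞ = 0`, so finiteness of the product forces both
  -- factors to be finite.
  have hct : cbNorm f ≠ ∞ := fun h0 => by simp [h0, ENNReal.top_mul hd0] at hlt
  have hdt : invCbNorm f ≠ ∞ := fun h0 => by simp [h0, ENNReal.mul_top hc0] at hlt
  refine ⟨_, _, ENNReal.toReal_pos hc0 hct, ENNReal.toReal_pos hd0 hdt, ?_,
    cbLE_toReal hct, cbGE_toReal hdt⟩
  rw [← ENNReal.toReal_mul, mul_comm]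
  exact ENNReal.toReal_le_of_le_ofReal hr hmul

theorem distortion_le {f : V →ₗ[ℂ] W} {c d : ℝ} (hc : 0 ≤ c) (hd : 0 ≤ d) (h : CbLE f c)
    (h' : CbGE f d) : distortion f ≤ ENNReal.ofReal (max 1 (c * d)) := by
  rw [distortion, ENNReal.ofReal_max, ENNReal.ofReal_one, ENNReal.ofReal_mul hc]
  exact max_le_max le_rfl (mul_le_mul' ((cbNorm_le_ofReal_iff hc).2 h)
    ((invCbNorm_le_ofReal_iff hd).2 h'))

end CbBounds

/-! ### Automatic complete boundedness on finite dimensional domains. -/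

section FiniteDimensional

variable {H : Type u} [NormedAddCommGroup H] [InnerProductSpace ℂ H]
variable {K : Type u} [NormedAddCommGroup K] [InnerProductSpace ℂ K]

/-- The compression `d* a c` of an operator matrix by scalar vectors: apply the matrix to the vector
with coordinates `c j • x`, then use Cauchy-Schwarz against `d`. -/
theorem norm_sum_smul_le {n : ℕ} (a : Matrix (Fin n) (Fin n) (H →L[ℂ] H))
    (c d : EuclideanSpace ℂ (Fin n)) :
    ‖∑ i, ∑ j, (star (d i) * c j) • a i j‖ ≤ ‖d‖ * (‖matrixOp a‖ * ‖c‖) := by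
  refine ContinuousLinearMap.opNorm_le_bound _ (by positivity) fun x => ?_
  set ξ : PiLp 2 (fun _ : Fin n => H) := WithLp.toLp 2 fun j => c j • x with hξ
  have hξn : ‖ξ‖ = ‖c‖ * ‖x‖ := by
    rw [EuclideanSpace.norm_eq, PiLp.norm_eq_of_L2]
    simp only [hξ, norm_smul, mul_pow]
    rw [← Finset.sum_mul, Real.sqrt_mul (by positivity), Real.sqrt_sq (norm_nonneg _)]
  have h1 : (∑ i, ∑ j, (star (d i) * c j) • a i j) x = ∑ i, star (d i) • matrixOp a ξ i := by
    simp only [matrixOp_apply, Finset.smul_sum, sum_apply,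
      smul_apply, hξ, map_smul, smul_smul]
  rw [h1]
  calc ‖∑ i, star (d i) • matrixOp a ξ i‖ ≤ ∑ i, ‖d i‖ * ‖matrixOp a ξ i‖ := by
        refine (norm_sum_le _ _).trans (Finset.sum_le_sum fun i _ => ?_)
        rw [norm_smul, norm_star]
    _ ≤ √(∑ i, ‖d i‖ ^ 2) * √(∑ i, ‖matrixOp a ξ i‖ ^ 2) :=
        Real.sum_mul_le_sqrt_mul_sqrt _ _ _
    _ = ‖d‖ * ‖matrixOp a ξ‖ := by rw [EuclideanSpace.norm_eq, PiLp.norm_eq_of_L2]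
    _ ≤ ‖d‖ * (‖matrixOp a‖ * ‖ξ‖) := by gcongr; exact ContinuousLinearMap.le_opNorm _ _
    _ = ‖d‖ * (‖matrixOp a‖ * ‖c‖) * ‖x‖ := by rw [hξn]; ring

variable {V : Submodule ℂ (H →L[ℂ] H)}

/-- Functionals are completely bounded. -/
theorem sum_norm_sq_functional_le (φ : V →ₗ[ℂ] ℂ) {M : ℝ} (hM : 0 ≤ M)
    (hφ : ∀ x, ‖φ x‖ ≤ M * ‖x‖) {n : ℕ} (a : Matrix (Fin n) (Fin n) V) (c : Fin n → ℂ) :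
    ∑ i, ‖∑ j, φ (a i j) * c j‖ ^ 2 ≤ (M * mnorm a) ^ 2 * ∑ j, ‖c j‖ ^ 2 := by
  set c' : EuclideanSpace ℂ (Fin n) := WithLp.toLp 2 c with hc'
  set d : EuclideanSpace ℂ (Fin n) := WithLp.toLp 2 fun i => ∑ j, φ (a i j) * c j with hd
  have hdn : ‖d‖ ^ 2 = ∑ i, ‖∑ j, φ (a i j) * c j‖ ^ 2 := by
    rw [EuclideanSpace.norm_sq_eq]
  have hcn : ‖c'‖ ^ 2 = ∑ j, ‖c j‖ ^ 2 := by
    rw [EuclideanSpace.norm_sq_eq]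
  rw [← hdn, ← hcn]
  -- With `d = φ(a) c`, the square `‖d‖²` is the value of `φ` at the compression `d* a c`, so the
  -- plain norm bound on `φ` applies.
  have h1 : ((‖d‖ ^ 2 : ℝ) : ℂ) = φ (∑ i, ∑ j, (star (d i) * c' j) • a i j) := by
    simp only [map_sum, map_smul, smul_eq_mul]
    rw [EuclideanSpace.norm_sq_eq]
    push_cast
    refine Finset.sum_congr rfl fun i _ => ?_
    rw [← Complex.conj_mul']
    conv_lhs => rw [show d i = ∑ j, φ (a i j) * c j from rfl]
    rw [Finset.mul_sum]
    refine Finset.sum_congr rfl fun j _ => ?_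
    simp only [hd, hc', Complex.star_def]
    ring
  have h2 : ‖d‖ ^ 2 ≤ M * (‖d‖ * (mnorm a * ‖c'‖)) := by
    have h3 : ‖d‖ ^ 2 = ‖φ (∑ i, ∑ j, (star (d i) * c' j) • a i j)‖ := by
      rw [← h1, Complex.norm_real, Real.norm_of_nonneg (by positivity)]
    rw [h3]
    refine (hφ _).trans (mul_le_mul_of_nonneg_left ?_ hM)
    have h4 := norm_sum_smul_le (a.map (fun x => (x : H →L[ℂ] H))) c' d
    refine le_trans (le_of_eq ?_) h4
    rw [← Submodule.norm_coe]
    simp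
  have h5 : ‖d‖ ≤ M * mnorm a * ‖c'‖ := by
    rcases (norm_nonneg d).eq_or_lt with h0 | h0
    · rw [← h0]
      exact mul_nonneg (mul_nonneg hM (mnorm_nonneg _)) (norm_nonneg _)
    · refine le_of_mul_le_mul_left ?_ h0
      nlinarith
  calc ‖d‖ ^ 2 ≤ (M * mnorm a * ‖c'‖) ^ 2 := by gcongr
    _ = _ := by ring

/-- A scalar matrix has the same norm when it acts on `ℂⁿ` and on `Kⁿ`. -/
theorem sum_norm_sq_amplification_le {n : ℕ} (t : Matrix (Fin n) (Fin n) ℂ) {M : ℝ}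
    (ht : ∀ c : Fin n → ℂ, ∑ i, ‖∑ j, t i j * c j‖ ^ 2 ≤ M * ∑ j, ‖c j‖ ^ 2) (ζ : Fin n → K) :
    ∑ i, ‖∑ j, t i j • ζ j‖ ^ 2 ≤ M * ∑ j, ‖ζ j‖ ^ 2 := by
  -- Only the span of the vectors matters. In an orthonormal basis of it the scalar matrix acts on
  -- each coordinate separately, and completeness of `K` is not needed.
  set P : Submodule ℂ K := Submodule.span ℂ (Set.range ζ) with hP
  have : FiniteDimensional ℂ P := FiniteDimensional.span_of_finite ℂ (Set.finite_range ζ)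
  set z : Fin n → P := fun j => ⟨ζ j, Submodule.subset_span ⟨j, rfl⟩⟩ with hz
  let b := stdOrthonormalBasis ℂ P
  have h1 : ∀ v : P, ‖v‖ ^ 2 = ∑ k, ‖inner ℂ (b k) v‖ ^ 2 := fun v =>
    (b.sum_sq_norm_inner_right v).symm
  have h2 : ∀ i, ‖∑ j, t i j • ζ j‖ ^ 2 = ∑ k, ‖∑ j, t i j * inner ℂ (b k) (z j)‖ ^ 2 := by
    intro i
    have h3 : ‖∑ j, t i j • ζ j‖ = ‖∑ j, t i j • z j‖ := by
      rw [← Submodule.norm_coe]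
      simp [hz]
    rw [h3, h1]
    simp only [inner_sum, inner_smul_right]
  have h4 : ∀ j, ‖ζ j‖ ^ 2 = ∑ k, ‖inner ℂ (b k) (z j)‖ ^ 2 := fun j => h1 (z j)
  simp only [h2, h4]
  rw [Finset.sum_comm, Finset.sum_comm (s := Finset.univ (α := Fin n)), Finset.mul_sum]
  exact Finset.sum_le_sum fun k _ => ht _

theorem exists_functional_bound {E : Type*} [NormedAddCommGroup E] [NormedSpace ℂ E]
    [FiniteDimensional ℂ E] (φ : E →ₗ[ℂ] ℂ) : ∃ M : ℝ, 0 ≤ M ∧ ∀ x, ‖φ x‖ ≤ M * ‖x‖ :=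
  ⟨_, norm_nonneg (LinearMap.toContinuousLinearMap φ),
    (LinearMap.toContinuousLinearMap φ).le_opNorm⟩

variable {W : Submodule ℂ (K →L[ℂ] K)}

/-- A rank one map sends the matrix `a` to `φ(a) ⊗ w`, and the scalar matrix `φ(a)` has norm at most
`M * mnorm a`. -/
theorem cbLE_smulRight (φ : V →ₗ[ℂ] ℂ) {M : ℝ} (hM : 0 ≤ M) (hφ : ∀ x, ‖φ x‖ ≤ M * ‖x‖)
    (w : W) : CbLE (φ.smulRight w) (M * ‖w‖) := fun n a => by
  refine ContinuousLinearMap.opNorm_le_bound _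
    (mul_nonneg (by positivity) (mnorm_nonneg _)) fun ξ => ?_
  set w' : K →L[ℂ] K := (w : K →L[ℂ] K) with hw'
  have hw : ‖w‖ = ‖w'‖ := rfl
  have h1 := sum_norm_sq_amplification_le (fun i j => φ (a i j))
    (sum_norm_sq_functional_le φ hM hφ a) (fun j => w' (ξ j))
  have h2 : ∑ j, ‖w' (ξ j)‖ ^ 2 ≤ (‖w'‖ * ‖ξ‖) ^ 2 := by
    rw [mul_pow, PiLp.norm_sq_eq_of_L2, Finset.mul_sum]
    refine Finset.sum_le_sum fun j _ => ?_
    rw [← mul_pow]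
    gcongr
    exact w'.le_opNorm _
  refine le_of_sq_le_sq ?_ (mul_nonneg (mul_nonneg (by positivity) (mnorm_nonneg _))
    (norm_nonneg _))
  rw [PiLp.norm_sq_eq_of_L2]
  simp only [matrixOp_apply]
  calc _ = ∑ i, ‖∑ j, φ (a i j) • w' (ξ j)‖ ^ 2 := by
        simp [hw']
    _ ≤ (M * mnorm a) ^ 2 * (‖w'‖ * ‖ξ‖) ^ 2 := h1.trans (by gcongr)
    _ = _ := by rw [hw]; ring

/-- On a finite dimensional space, the norm and the completely bounded norm are equivalent, with
a constant that depends only on the domain. -/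
theorem exists_cbLE_of_norm_le (V : Submodule ℂ (H →L[ℂ] H)) [FiniteDimensional ℂ V] :
    ∃ C : ℝ, 0 < C ∧ ∀ {K : Type u} [NormedAddCommGroup K] [InnerProductSpace ℂ K]
      {W : Submodule ℂ (K →L[ℂ] K)} (f : V →ₗ[ℂ] W) (c : ℝ), 0 ≤ c →
      (∀ x, ‖f x‖ ≤ c * ‖x‖) → CbLE f (C * c) := by
  let b := Module.finBasis ℂ V
  choose M hM0 hM using fun k => exists_functional_bound (E := V) (b.coord k)
  have hC : 0 ≤ ∑ k, M k * ‖b k‖ := Finset.sum_nonneg fun k _ => mul_nonneg (hM0 k) (norm_nonneg _)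
  refine ⟨∑ k, M k * ‖b k‖ + 1, by positivity, fun {K} _ _ {W} f c hc hf n a => ?_⟩
  -- Expansion of `f` into rank one maps along a basis of the domain. Only the values `f (b k)`
  -- involve the target, whence the uniform constant.
  have h1 : a.map f = ∑ k, a.map ((b.coord k).smulRight (f (b k))) := by
    ext1 i j
    rw [Matrix.sum_apply]
    simp only [Matrix.map_apply, LinearMap.smulRight_apply, Module.Basis.coord_apply]
    conv_lhs => rw [← b.sum_repr (a i j), map_sum]
    simp only [map_smul]
  rw [h1]
  refine (mnorm_sum_le _ _).trans ?_
  have h2 : ∀ k, mnorm (a.map ((b.coord k).smulRight (f (b k)))) ≤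
      M k * ‖b k‖ * c * mnorm a := by
    intro k
    refine (cbLE_smulRight (b.coord k) (hM0 k) (hM k) (f (b k)) n a).trans ?_
    refine mul_le_mul_of_nonneg_right ?_ (mnorm_nonneg _)
    rw [mul_assoc, mul_comm ‖b k‖]
    exact mul_le_mul_of_nonneg_left (hf _) (hM0 k)
  refine (Finset.sum_le_sum fun k _ => h2 k).trans ?_
  rw [← Finset.sum_mul, ← Finset.sum_mul]
  refine mul_le_mul_of_nonneg_right ?_ (mnorm_nonneg _)
  gcongr
  linarith

end FiniteDimensional

theorem exists_one_lt_pow_lt {κ : ℝ} (hκ : 1 < κ) (n : ℕ) : ∃ t : ℝ, 1 < t ∧ t ^ n < κ := by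
  have h1 : Filter.Tendsto (fun t : ℝ => t ^ n) (𝓝[>] 1) (𝓝 ((1 : ℝ) ^ n)) :=
    ((continuous_pow n).tendsto 1).mono_left nhdsWithin_le_nhds
  rw [one_pow] at h1
  have h2 := h1.eventually (eventually_lt_nhds hκ)
  obtain ⟨t, ht, ht'⟩ := (h2.and self_mem_nhdsWithin).exists
  exact ⟨t, ht', ht⟩

/-! ### Extension, perturbation and the back-and-forth step. -/

section Extension

variable {𝓔 : Set FDOpSpace.{u}}
variable {H : Type u} [NormedAddCommGroup H] [InnerProductSpace ℂ H]
variable {K : Type u} [NormedAddCommGroup K] [InnerProductSpace ℂ K]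
variable {V : Submodule ℂ (H →L[ℂ] H)} {Y : Submodule ℂ (K →L[ℂ] K)}

/-- The Gurarii property for maps between subspaces, with bounds on both cb norms. -/
theorem HasGurariiProperty.exists_extension (hY : HasGurariiProperty 𝓔 Y) {L : FDOpSpace.{u}}
    (hL : L ∈ 𝓔) {S : Submodule ℂ (L.H →L[ℂ] L.H)} (hS : S ≤ L.carrier) {f : S →ₗ[ℂ] Y}
    {κ κ' : ℝ} (hκ : 1 ≤ κ) (hf : IsCbEmb κ f) (hκ' : κ ^ 3 < κ') :
    ∃ g : L.carrier →ₗ[ℂ] Y, g ∘ₗ Submodule.inclusion hS = f ∧ IsCbEmb κ' g := by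
  have hκ3 : 1 ≤ κ ^ 3 := one_le_pow₀ hκ
  by_cases hL0 : Nontrivial L.carrier
  swap
  · have : Subsingleton L.carrier := not_nontrivial_iff_subsingleton.1 hL0
    have : Subsingleton S := (Submodule.inclusion_injective hS).subsingleton
    refine ⟨0, ?_, cbLE_of_subsingleton _ _, cbGE_of_subsingleton _ _⟩
    ext1 x
    rw [Subsingleton.elim x 0, map_zero, map_zero]
  -- Two factors `κ` come from `distortion f ≤ κ * κ`; the third is lost in splitting the distortion
  -- of `g` into its two norms.
  set ε : ℝ := κ' / κ ^ 3 - 1 with hε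
  have hε0 : 0 < ε := by
    rw [hε, sub_pos, one_lt_div (by positivity)]
    exact hκ'
  have hεκ : (1 + ε) * κ ^ 3 = κ' := by
    rw [hε]; field_simp; ring
  obtain ⟨g, hg, hgf, hgD⟩ := hY ε hε0 L hL S hS f hf.2.injective
  have hD : distortion f ≤ ENNReal.ofReal (κ * κ) := by
    refine (distortion_le (by linarith) (by linarith) hf.1 hf.2).trans ?_
    exact ENNReal.ofReal_le_ofReal (max_le (by nlinarith) le_rfl)
  by_cases hS0 : Nontrivial S
  · have hgD' : distortion g ≤ ENNReal.ofReal ((1 + ε) * (κ * κ)) := by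
      rw [ENNReal.ofReal_mul (by linarith)]
      exact hgD.trans (by gcongr)
    obtain ⟨c, d, hc, hd, hcd, hgc, hgd⟩ :=
      exists_bounds_of_distortion_le hg (by positivity) hgD'
    obtain ⟨x, hx⟩ := exists_ne (0 : S)
    have hx0 : 0 < ‖x‖ := norm_pos_iff.2 hx
    have hgx : g (Submodule.inclusion hS x) = f x := LinearMap.congr_fun hgf x
    have hix : ‖Submodule.inclusion hS x‖ = ‖x‖ := rfl
    have h1 := hf.1.norm_le x
    have h2 := hf.2.norm_le x
    have h3 := hgc.norm_le (Submodule.inclusion hS x)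
    have h4 := hgd.norm_le (Submodule.inclusion hS x)
    rw [hgx, hix] at h3 h4
    -- As `g` agrees with `f` at some `x ≠ 0`, neither of its two norms is below `κ⁻¹`. A bound on
    -- the product then bounds each factor.
    have hκc : 1 ≤ κ * c := by
      have h5 : κ * ‖f x‖ ≤ κ * (c * ‖x‖) := by gcongr
      nlinarith
    have hκd : 1 ≤ d * κ := by
      have h5 : d * ‖f x‖ ≤ d * (κ * ‖x‖) := by gcongr
      nlinarith
    refine ⟨g, hgf, hgc.mono ?_, hgd.mono ?_⟩
    · calc c ≤ (d * κ) * c := le_mul_of_one_le_left hc.le hκd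
        _ = (d * c) * κ := by ring
        _ ≤ ((1 + ε) * (κ * κ)) * κ := by gcongr
        _ = κ' := by rw [← hεκ]; ring
    · calc d ≤ (κ * c) * d := le_mul_of_one_le_left hd.le hκc
        _ = (d * c) * κ := by ring
        _ ≤ ((1 + ε) * (κ * κ)) * κ := by gcongr
        _ = κ' := by rw [← hεκ]; ring
  · have : Subsingleton S := not_nontrivial_iff_subsingleton.1 hS0
    have hD1 : distortion f ≤ ENNReal.ofReal 1 := by
      refine (distortion_le le_rfl le_rfl (cbLE_of_subsingleton f 0)
        (cbGE_of_subsingleton f 0)).trans ?_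
      simp
    have hgD' : distortion g ≤ ENNReal.ofReal (1 + ε) := by
      refine hgD.trans ?_
      calc _ ≤ ENNReal.ofReal (1 + ε) * ENNReal.ofReal 1 := by gcongr
        _ = _ := by simp
    obtain ⟨c, d, hc, hd, hcd, hgc, hgd⟩ :=
      exists_bounds_of_distortion_le hg (by positivity) hgD'
    have hle : 1 + ε ≤ κ' := by
      rw [← hεκ]
      exact le_mul_of_one_le_right (by linarith) hκ3
    -- For `S = 0` nothing fixes the scale of `g`, but nothing prevents rescaling it either.
    refine ⟨((c⁻¹ : ℝ) : ℂ) • g, ?_, (hgc.smul (by positivity)).mono ?_,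
      (hgd.smul (by positivity)).mono ?_⟩
    · ext1 x
      rw [Subsingleton.elim x 0, map_zero, map_zero]
    · rw [inv_mul_cancel₀ hc.ne']; linarith
    · rw [inv_inv]; linarith

/-- The Gurarii property applied to `p ∘ w⁻¹` on the subspace `w(V)` of `L`. -/
theorem HasGurariiProperty.exists_extension_of_isCbEmb (hY : HasGurariiProperty 𝓔 Y)
    {L : FDOpSpace.{u}} (hL : L ∈ 𝓔) {w : V →ₗ[ℂ] L.carrier} {p : V →ₗ[ℂ] Y} {κ₁ κ₂ κ' : ℝ}
    (h₁ : 1 ≤ κ₁) (h₂ : 1 ≤ κ₂) (hw : IsCbEmb κ₁ w) (hp : IsCbEmb κ₂ p)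
    (hκ' : (κ₂ * κ₁) ^ 3 < κ') :
    ∃ h : L.carrier →ₗ[ℂ] Y, h ∘ₗ w = p ∧ IsCbEmb κ' h := by
  obtain ⟨h, hh, hh'⟩ := hY.exists_extension hL (rangeIn_le w)
    (f := p ∘ₗ inverseOnRange w hw.2.injective) (κ := κ₂ * κ₁) (one_le_mul_of_one_le_of_one_le h₂ h₁)
    (hp.comp (isCbEmb_inverseOnRange hw) (by linarith) (by linarith)) hκ'
  refine ⟨h, ?_, hh'⟩
  ext1 x
  have h3 := LinearMap.congr_fun hh (toRange w x)
  simp only [LinearMap.comp_apply, inverseOnRange_toRange] at h3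
  exact h3

variable {X : Submodule ℂ (H →L[ℂ] H)}

/-- Normalizing to a complete contraction puts all the distortion on the inverse;
`exists_map_range_of_mul_lt` relies on this one-sided form. -/
theorem LocallyEmbeds.exists_map (h𝓔 : IsClass 𝓔) (hX : LocallyEmbeds 𝓔 X)
    (F : Submodule ℂ (H →L[ℂ] H)) [hF : FiniteDimensional ℂ F] (hFX : F ≤ X) {κ : ℝ} (hκ : 1 < κ) :
    ∃ L ∈ 𝓔, ∃ w : F →ₗ[ℂ] L.carrier, CbLE w 1 ∧ CbGE w κ := by
  by_cases hF0 : Nontrivial F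
  swap
  · have : Subsingleton F := not_nontrivial_iff_subsingleton.1 hF0
    obtain ⟨L, hL, -⟩ := h𝓔.nontrivial
    exact ⟨L, hL, 0, cbLE_of_subsingleton _ _, cbGE_of_subsingleton _ _⟩
  obtain ⟨L, hL, G, hG, hd⟩ := hX F hF hFX ((κ - 1) / 2) (by linarith)
  have hlt : dcb F G < ENNReal.ofReal κ := by
    refine hd.trans_lt ?_
    rw [ENNReal.ofReal_lt_ofReal_iff (by linarith)]
    linarith
  obtain ⟨w, hw⟩ := iInf_lt_iff.1 hlt
  obtain ⟨c, d, hc, hd, hcd, hwc, hwd⟩ :=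
    exists_bounds_of_distortion_le (f := (w : F →ₗ[ℂ] G)) w.injective (by linarith) hw.le
  refine ⟨L, hL, Submodule.inclusion hG ∘ₗ (((c⁻¹ : ℝ) : ℂ) • (w : F →ₗ[ℂ] G)), ?_, ?_⟩
  · refine ((isCbEmb_inclusion hG).1.comp (hwc.smul (by positivity)) zero_le_one).mono ?_
    rw [inv_mul_cancel₀ hc.ne', one_mul]
  · refine ((isCbEmb_inclusion hG).2.comp (hwd.smul (by positivity)) (by positivity)).mono ?_
    rw [inv_inv, one_mul, mul_comm]
    exact hcd

theorem isCbEmb_toRange {f : V →ₗ[ℂ] Y} {κ : ℝ} (h : IsCbEmb κ f) : IsCbEmb κ (toRange f) :=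
  ⟨fun n a => h.1 n a, fun n a => h.2 n a⟩

theorem finiteDimensional_rangeIn [FiniteDimensional ℂ V] (f : V →ₗ[ℂ] Y) :
    FiniteDimensional ℂ (rangeIn f) :=
  inferInstanceAs (FiniteDimensional ℂ (LinearMap.range (Y.subtype ∘ₗ f)))

/-- An `η`-embedding of a member of `𝓔` in a Gurarii space whose range is almost a subspace of a
member of `𝓔` is `δ η`-close to almost isometric embeddings. -/
theorem IsPerturbationFunction.exists_near {δ : ℝ → ℝ} (hδ : IsPerturbationFunction 𝓔 δ)
    (hY : HasGurariiProperty 𝓔 Y) {E : FDOpSpace.{u}} (hE : E ∈ 𝓔) (f : E.carrier →ₗ[ℂ] Y)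
    {η : ℝ} (hη : 0 < η)
    (hw : ∀ κ : ℝ, 1 < κ → ∃ L ∈ 𝓔, ∃ w : rangeIn f →ₗ[ℂ] L.carrier, IsCbEmb κ w ∧
      IsCbEmb (1 + η) (w ∘ₗ toRange f)) {κ ρ : ℝ} (hκ : 1 < κ) (hρ : 0 < ρ) :
    ∃ g : E.carrier →ₗ[ℂ] Y, IsCbEmb κ g ∧ CbLE (g - f) (δ η + ρ) := by
  have hδη := hδ.pos η hη
  obtain ⟨t, ht1, ht⟩ := exists_one_lt_pow_lt (κ := min κ (1 + ρ / δ η))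
    (lt_min hκ (by linarith [div_pos hρ hδη])) 8
  have ht0 : 0 ≤ t := by linarith
  obtain ⟨L, hL, w, hwt, hwη⟩ := hw t ht1
  -- Perturbation with `S` all of `E` and target `L`: `g` improves `w ∘ f` once `L` is enlarged to
  -- `E₁`.
  obtain ⟨E₁, hE₁, φ, g, hφ, hg, hgφ⟩ := hδ.perturb η hη E hE L hL E.carrier le_rfl
    (w ∘ₗ toRange f) ((isEpsEmbedding_iff hη).2 hwη) (t - 1) (by linarith)
  rw [isEpsEmbedding_iff (by linarith), add_sub_cancel] at hφ hg
  rw [cbNorm_le_ofReal_iff hδη.le] at hgφ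
  -- Return to `Y`: `h` inverts `φ ∘ w` on the range of `f`, so `h ∘ g - f = h ∘ (g - φ ∘ w ∘ f)`.
  -- The constants are `(t²)³ < t⁷` for `h` and `t⁸` for `h ∘ g`.
  obtain ⟨h, hh, ht7⟩ := hY.exists_extension_of_isCbEmb hE₁ (w := φ ∘ₗ w)
    (p := Submodule.inclusion (rangeIn_le f)) (κ₁ := t * t) (κ₂ := 1) (κ' := t ^ 7)
    (by nlinarith) le_rfl (hφ.comp hwt ht0 ht0) (isCbEmb_inclusion _) (by
      rw [one_mul, ← pow_two, ← pow_mul]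
      exact pow_lt_pow_right₀ ht1 (by norm_num))
  refine ⟨h ∘ₗ g, (ht7.comp hg ht0 (by positivity)).mono ?_, ?_⟩
  · calc t ^ 7 * t = t ^ 8 := by ring
      _ ≤ κ := ht.le.trans (min_le_left _ _)
  · have h1 : h ∘ₗ g - f = h ∘ₗ (g ∘ₗ Submodule.inclusion le_rfl - φ ∘ₗ w ∘ₗ toRange f) := by
      ext1 x
      have h2 := LinearMap.congr_fun hh (toRange f x)
      have h3 : Submodule.inclusion (rangeIn_le f) (toRange f x) = f x := rfl
      rw [h3] at h2
      simp only [LinearMap.sub_apply, LinearMap.comp_apply, map_sub] at h2 ⊢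
      rw [h2]
      rfl
    rw [h1]
    refine (ht7.1.comp hgφ (by positivity)).mono ?_
    have h2 : t ^ 7 ≤ 1 + ρ / δ η := by
      refine le_trans ?_ (ht.le.trans (min_le_right _ _))
      exact pow_le_pow_right₀ ht1.le (by norm_num)
    calc t ^ 7 * δ η ≤ (1 + ρ / δ η) * δ η := by gcongr
      _ = δ η + ρ := by field_simp

/-- One step of the back-and-forth: a pair of almost isometric embeddings in `X` and `Y` is
enlarged so that the image in `X` contains a given point. -/
theorem exists_enlargement {δ : ℝ → ℝ} (h𝓔 : IsPerturbativeGurariiClass 𝓔 δ)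
    (hX : HasGurariiProperty 𝓔 X) (hX' : LocallyEmbeds 𝓔 X)
    (hY : HasGurariiProperty 𝓔 Y) (hY' : LocallyEmbeds 𝓔 Y) {τ : ℝ} (hτ : 0 < τ) :
    ∃ κ : ℝ, 1 < κ ∧ ∀ L ∈ 𝓔, ∀ (a : L.carrier →ₗ[ℂ] X) (b : L.carrier →ₗ[ℂ] Y),
      IsCbEmb κ a → IsCbEmb κ b → ∀ (x : X) (κ' : ℝ), 1 < κ' →
      ∃ L' ∈ 𝓔, ∃ (a' : L'.carrier →ₗ[ℂ] X) (b' : L'.carrier →ₗ[ℂ] Y)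
        (j : L.carrier →ₗ[ℂ] L'.carrier), IsCbEmb κ' a' ∧ IsCbEmb κ' b' ∧
        a' ∘ₗ j = a ∧ (∀ z, ‖b' (j z) - b z‖ ≤ τ * ‖b z‖) ∧ x ∈ LinearMap.range a' := by
  -- The tolerance fixes `η`, and `η` fixes `κ`; the later `κ'` plays no part in this choice.
  have h1 : ∀ᶠ η in 𝓝[>] (0 : ℝ), δ η < τ / 16 :=
    h𝓔.perturbative.tendsto.eventually (eventually_lt_nhds (by positivity))
  obtain ⟨η, hδη, hη : 0 < η⟩ := (h1.and self_mem_nhdsWithin).exists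
  obtain ⟨κ, hκ1, hκ⟩ := exists_one_lt_pow_lt (κ := min (1 + η) 2)
    (lt_min (by linarith) (by norm_num)) 11
  have hκη : κ ^ 11 < 1 + η := hκ.trans_le (min_le_left _ _)
  have hκ2 : κ ^ 11 < 2 := hκ.trans_le (min_le_right _ _)
  have hκ0 : 0 ≤ κ := by linarith
  refine ⟨κ, hκ1, fun L hL a b ha hb x κ' hκ' => ?_⟩
  set F : Submodule ℂ (H →L[ℂ] H) := rangeIn a ⊔ Submodule.span ℂ {(x : H →L[ℂ] H)} with hF
  have hFX : F ≤ X := sup_le (rangeIn_le a) (by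
    rw [Submodule.span_le, Set.singleton_subset_iff]; exact x.2)
  have := finiteDimensional_rangeIn a
  have hFfd : FiniteDimensional ℂ F := Submodule.finiteDimensional_sup _ _
  have hxF : (x : H →L[ℂ] H) ∈ F := Submodule.mem_sup_right (Submodule.mem_span_singleton_self _)
  obtain ⟨t, ht1, ht⟩ := exists_one_lt_pow_lt (κ := min κ κ') (lt_min hκ1 hκ') 4
  have ht0 : 0 ≤ t := by linarith
  have htκ : t ≤ κ := by
    calc t = t ^ 1 := (pow_one t).symm
      _ ≤ t ^ 4 := pow_le_pow_right₀ ht1.le (by norm_num)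
      _ ≤ κ := ht.le.trans (min_le_left _ _)
  obtain ⟨L', hL', w, hw1, hw2⟩ := hX'.exists_map h𝓔.isClass F hFX ht1
  have hw : IsCbEmb t w := ⟨hw1.mono ht1.le, hw2⟩
  obtain ⟨a', ha'w, ha'⟩ := hX.exists_extension_of_isCbEmb hL' (w := w)
    (p := Submodule.inclusion hFX) (κ₁ := t) (κ₂ := 1) (κ' := t ^ 4) ht1.le le_rfl hw
    (isCbEmb_inclusion _) (by rw [one_mul]; exact pow_lt_pow_right₀ ht1 (by norm_num))
  set i : L.carrier →ₗ[ℂ] F := Submodule.inclusion le_sup_left ∘ₗ toRange a with hi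
  have hiemb : IsCbEmb κ i := by
    have h2 := (isCbEmb_inclusion (le_sup_left : rangeIn a ≤ F)).comp (isCbEmb_toRange ha) hκ0
      zero_le_one
    rwa [one_mul] at h2
  have hj : IsCbEmb (κ * κ) (w ∘ₗ i) :=
    (hw.comp hiemb hκ0 ht0).mono (by gcongr)
  -- An exact extension of `b` through `j = w ∘ i`, but with the degraded constant `κ ^ 10`. One
  -- more `κ`, from embedding its range in a member, gives the exponent `11`.
  obtain ⟨b₀, hb₀j, hb₀⟩ := hY.exists_extension_of_isCbEmb hL' (w := w ∘ₗ i) (p := b)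
    (κ₁ := κ * κ) (κ₂ := κ) (κ' := κ ^ 10) (by nlinarith) hκ1.le hj hb (by
      calc (κ * (κ * κ)) ^ 3 = κ ^ 9 := by ring
        _ < κ ^ 10 := pow_lt_pow_right₀ hκ1 (by norm_num))
  -- Perturbation restores the quality to `κ'` at the cost of moving `b₀` by at most `δ η + τ / 16`,
  -- which is below `τ / 8`.
  have hpert := h𝓔.perturbative.exists_near hY hL' b₀ hη (κ := κ') (ρ := τ / 16) (fun κ₁ hκ₁ => by
    have := finiteDimensional_rangeIn b₀
    obtain ⟨M, hM, v, hv1, hv2⟩ := hY'.exists_map h𝓔.isClass (rangeIn b₀) (rangeIn_le b₀)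
      (κ := min κ₁ κ) (lt_min hκ₁ hκ1)
    have hv : IsCbEmb (min κ₁ κ) v := ⟨hv1.mono (le_min hκ₁.le hκ1.le), hv2⟩
    refine ⟨M, hM, v, hv.mono (min_le_left _ _), ?_⟩
    refine ((hv.mono (min_le_right _ _)).comp (isCbEmb_toRange hb₀) (by positivity) hκ0).mono ?_
    calc κ * κ ^ 10 = κ ^ 11 := by ring
      _ ≤ 1 + η := hκη.le) hκ' (by positivity)
  obtain ⟨b', hb', hb'b₀⟩ := hpert
  refine ⟨L', hL', a', b', w ∘ₗ i, ha'.mono (ht.le.trans (min_le_right _ _)), hb', ?_, ?_, ?_⟩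
  · rw [← LinearMap.comp_assoc, ha'w]
    rfl
  · intro z
    have h2 : b₀ ((w ∘ₗ i) z) = b z := LinearMap.congr_fun hb₀j z
    have h3 := hb'b₀.norm_le ((w ∘ₗ i) z)
    rw [LinearMap.sub_apply, h2] at h3
    refine h3.trans ?_
    have h4 : ‖(w ∘ₗ i) z‖ ≤ 8 * ‖b z‖ := by
      calc ‖(w ∘ₗ i) z‖ ≤ κ * κ * ‖z‖ := hj.1.norm_le z
        _ ≤ κ * κ * (κ * ‖b z‖) := by gcongr; exact hb.2.norm_le z
        _ = κ ^ 3 * ‖b z‖ := by ring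
        _ ≤ 8 * ‖b z‖ := by
          gcongr
          have : κ ^ 3 ≤ κ ^ 11 := pow_le_pow_right₀ hκ1.le (by norm_num)
          linarith
    have hδη0 := h𝓔.perturbative.pos η hη
    calc (δ η + τ / 16) * ‖(w ∘ₗ i) z‖ ≤ (τ / 16 + τ / 16) * (8 * ‖b z‖) := by gcongr
      _ = τ * ‖b z‖ := by ring
  · exact ⟨w ⟨x, hxF⟩, LinearMap.congr_fun ha'w ⟨x, hxF⟩⟩

end Extension

/-! ### Limits of almost isometric partial maps. -/

section Limit

/-- The points that are limits of points of the subspaces `R m`. -/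
def limitSubmodule {Z : Type*} [NormedAddCommGroup Z] [NormedSpace ℂ Z] (R : ℕ → Submodule ℂ Z) :
    Submodule ℂ Z where
  carrier := {p | ∀ θ : ℝ, 0 < θ → ∀ᶠ m in Filter.atTop, ∃ q ∈ R m, ‖q - p‖ < θ}
  zero_mem' := fun θ hθ => Filter.Eventually.of_forall fun m => ⟨0, (R m).zero_mem, by simpa⟩
  add_mem' := by
    intro p p' hp hp' θ hθ
    filter_upwards [hp (θ / 2) (by positivity), hp' (θ / 2) (by positivity)] with m h h'
    obtain ⟨q, hq, hqp⟩ := h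
    obtain ⟨q', hq', hqp'⟩ := h'
    refine ⟨q + q', (R m).add_mem hq hq', ?_⟩
    rw [add_sub_add_comm]
    exact (norm_add_le _ _).trans_lt (by linarith)
  smul_mem' := by
    intro c p hp θ hθ
    filter_upwards [hp (θ / (‖c‖ + 1)) (by positivity)] with m h
    obtain ⟨q, hq, hqp⟩ := h
    refine ⟨c • q, (R m).smul_mem c hq, ?_⟩
    rw [← smul_sub, norm_smul]
    rw [lt_div_iff₀ (by positivity)] at hqp
    nlinarith [norm_nonneg (q - p), norm_nonneg c]

theorem isClosed_limitSubmodule {Z : Type*} [NormedAddCommGroup Z] [NormedSpace ℂ Z]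
    (R : ℕ → Submodule ℂ Z) : IsClosed (limitSubmodule R : Set Z) := by
  refine isClosed_of_closure_subset fun p hp θ hθ => ?_
  obtain ⟨p', hp', hpp'⟩ := Metric.mem_closure_iff.1 hp (θ / 2) (by positivity)
  filter_upwards [hp' (θ / 2) (by positivity)] with m h
  obtain ⟨q, hq, hqp⟩ := h
  refine ⟨q, hq, ?_⟩
  rw [dist_comm, dist_eq_norm] at hpp'
  calc ‖q - p‖ = ‖(q - p') + (p' - p)‖ := by congr 1; abel
    _ ≤ _ := norm_add_le _ _
    _ < θ := by linarith

/-- A closed subspace of `X × Y` whose elements have coordinates of equal norms, and whose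
projections are dense, is the graph of an isomorphism. -/
theorem exists_linearEquiv_of_graph {X Y : Type*} [NormedAddCommGroup X] [NormedSpace ℂ X]
    [CompleteSpace X] [NormedAddCommGroup Y] [NormedSpace ℂ Y] [CompleteSpace Y]
    (G : Submodule ℂ (X × Y)) (hG : IsClosed (G : Set (X × Y)))
    (hnorm : ∀ p ∈ G, ‖p.1‖ = ‖p.2‖) (h₁ : ∀ (x : X) (θ : ℝ), 0 < θ → ∃ p ∈ G, ‖p.1 - x‖ < θ)
    (h₂ : ∀ (y : Y) (θ : ℝ), 0 < θ → ∃ p ∈ G, ‖p.2 - y‖ < θ) :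
    ∃ f : X ≃ₗ[ℂ] Y, ∀ x, (x, f x) ∈ G := by
  have : CompleteSpace G := hG.completeSpace_coe
  -- In the sup norm of the product, equal coordinate norms make both projections isometric. Their
  -- ranges are then closed, and dense by assumption.
  let p₁ : G →ₗᵢ[ℂ] X := ⟨LinearMap.fst ℂ X Y ∘ₗ G.subtype, fun p => by
    have := hnorm p p.2
    simp [Prod.norm_def, this]⟩
  let p₂ : G →ₗᵢ[ℂ] Y := ⟨LinearMap.snd ℂ X Y ∘ₗ G.subtype, fun p => by
    have := hnorm p p.2
    simp [Prod.norm_def, this]⟩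
  have hs₁ : Function.Surjective p₁ := by
    rw [← Set.range_eq_univ, ← p₁.isometry.isClosedEmbedding.isClosed_range.closure_eq]
    refine Set.eq_univ_of_forall fun x => Metric.mem_closure_iff.2 fun θ hθ => ?_
    obtain ⟨p, hp, hpx⟩ := h₁ x θ hθ
    exact ⟨_, ⟨⟨p, hp⟩, rfl⟩, by rwa [dist_comm, dist_eq_norm]⟩
  have hs₂ : Function.Surjective p₂ := by
    rw [← Set.range_eq_univ, ← p₂.isometry.isClosedEmbedding.isClosed_range.closure_eq]
    refine Set.eq_univ_of_forall fun x => Metric.mem_closure_iff.2 fun θ hθ => ?_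
    obtain ⟨p, hp, hpx⟩ := h₂ x θ hθ
    exact ⟨_, ⟨⟨p, hp⟩, rfl⟩, by rwa [dist_comm, dist_eq_norm]⟩
  let e₁ : G ≃ₗ[ℂ] X := LinearEquiv.ofBijective p₁.toLinearMap ⟨p₁.injective, hs₁⟩
  let e₂ : G ≃ₗ[ℂ] Y := LinearEquiv.ofBijective p₂.toLinearMap ⟨p₂.injective, hs₂⟩
  refine ⟨e₁.symm.trans e₂, fun x => ?_⟩
  have h3 : (x, e₁.symm.trans e₂ x) = (e₁.symm x : X × Y) := by
    refine Prod.ext ?_ rfl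
    exact (e₁.apply_symm_apply x).symm
  rw [h3]
  exact (e₁.symm x).2

/-- The increments are bounded relative to the current norm. Since `c ≤ 1 / 4`, norms stay below `2
* ‖s 0‖`, and the increments are dominated by a geometric series of sum `4 * c * ‖s 0‖`. -/
theorem exists_tendsto_of_norm_sub_le {X : Type*} [NormedAddCommGroup X] [CompleteSpace X]
    (s : ℕ → X) {c : ℝ} (hc : 0 ≤ c) (hc' : c ≤ 1 / 4)
    (hs : ∀ m, ‖s (m + 1) - s m‖ ≤ c / 2 ^ m * ‖s m‖) :
    ∃ l, Filter.Tendsto s Filter.atTop (𝓝 l) ∧ ‖l - s 0‖ ≤ 4 * c * ‖s 0‖ := by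
  have h1 : ∀ m, ‖s m‖ ≤ (2 - 1 / 2 ^ m) * ‖s 0‖ := by
    intro m
    induction m with
    | zero => norm_num
    | succ m ih =>
      have h2 : ‖s (m + 1)‖ ≤ ‖s m‖ + ‖s (m + 1) - s m‖ := by
        simpa using norm_add_le (s m) (s (m + 1) - s m)
      set q : ℝ := 1 / 2 ^ m with hq
      have hq0 : 0 ≤ q := by positivity
      have hq1 : (1 : ℝ) / 2 ^ (m + 1) = q / 2 := by rw [hq, pow_succ]; field_simp
      have hcq : c / 2 ^ m = c * q := by rw [hq]; ring
      have h3 := hs m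
      rw [hcq] at h3
      rw [hq1]
      have h4 : c * q * ‖s m‖ ≤ (1 / 4 * q) * (2 * ‖s 0‖) := by
        gcongr
        nlinarith [norm_nonneg (s 0)]
      nlinarith
  have h2 : ∀ m, dist (s m) (s (m + 1)) ≤ 4 * c * ‖s 0‖ / 2 / 2 ^ m := by
    intro m
    rw [dist_comm, dist_eq_norm]
    have h3 : ‖s m‖ ≤ 2 * ‖s 0‖ := (h1 m).trans (by
      gcongr
      have : (0 : ℝ) ≤ 1 / 2 ^ m := by positivity
      linarith)
    calc _ ≤ c / 2 ^ m * ‖s m‖ := hs m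
      _ ≤ c / 2 ^ m * (2 * ‖s 0‖) := by gcongr
      _ = _ := by ring
  obtain ⟨l, hl⟩ := cauchySeq_tendsto_of_complete (cauchySeq_of_le_geometric_two h2)
  refine ⟨l, hl, ?_⟩
  rw [← dist_eq_norm, dist_comm]
  exact dist_le_of_le_geometric_two_of_tendsto₀ h2 hl

theorem exists_sequence {α : Type*} (P : ℕ → α → Prop) (R : ℕ → α → α → Prop) (s₀ : α)
    (h₀ : P 0 s₀) (h : ∀ n s, P n s → ∃ s', P (n + 1) s' ∧ R n s s') :
    ∃ s : ℕ → α, s 0 = s₀ ∧ ∀ n, P n (s n) ∧ R n (s n) (s (n + 1)) := by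
  choose! F hF using h
  let s : ℕ → α := fun n => Nat.rec s₀ (fun n s => F n s) n
  have hP : ∀ n, P n (s n) := fun n => by
    induction n with
    | zero => exact h₀
    | succ n ih => exact (hF n _ ih).1
  exact ⟨s, rfl, fun n => ⟨hP n, (hF n _ (hP n)).2⟩⟩

variable {H : Type u} [NormedAddCommGroup H] [InnerProductSpace ℂ H]
variable {K : Type u} [NormedAddCommGroup K] [InnerProductSpace ℂ K]
variable {X : Submodule ℂ (H →L[ℂ] H)} {Y : Submodule ℂ (K →L[ℂ] K)}

/-- In the limit, bounds with constants tending to `1` become complete contractivity. -/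
theorem mnorm_le_of_approx (κ : ℕ → ℝ) (hκ : Filter.Tendsto κ Filter.atTop (𝓝 1))
    (hκ0 : ∀ m, 0 ≤ κ m) (L : ℕ → FDOpSpace.{u})
    (a : ∀ m, (L m).carrier →ₗ[ℂ] X) (b : ∀ m, (L m).carrier →ₗ[ℂ] Y)
    (ha : ∀ m, CbLE (a m) (κ m)) (hb : ∀ m, CbGE (b m) (κ m))
    {n : ℕ} (x : Matrix (Fin n) (Fin n) X) (y : Matrix (Fin n) (Fin n) Y)
    (h : ∀ i j, ∀ θ : ℝ, 0 < θ → ∀ᶠ m in Filter.atTop,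
      ∃ z, ‖a m z - x i j‖ < θ ∧ ‖b m z - y i j‖ < θ) : mnorm x ≤ mnorm y := by
  have key : ∀ θ : ℝ, 0 < θ → ∀ᶠ m in Filter.atTop,
      mnorm x ≤ κ m * (κ m * (mnorm y + n * n * θ)) + n * n * θ := by
    intro θ hθ
    have h1 : ∀ᶠ m in Filter.atTop, ∀ i j, ∃ z, ‖a m z - x i j‖ < θ ∧ ‖b m z - y i j‖ < θ :=
      Filter.eventually_all.2 fun i => Filter.eventually_all.2 fun j => h i j θ hθ
    filter_upwards [h1] with m hm
    choose z hz hz' using hm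
    have h2 : mnorm x ≤ mnorm (Matrix.map (z : Matrix (Fin n) (Fin n) _) (a m)) + n * n * θ :=
      mnorm_le_add_of_forall_norm_sub_le _ _ fun i j => (norm_sub_rev _ _).trans_le (hz i j).le
    have h3 : mnorm (Matrix.map (z : Matrix (Fin n) (Fin n) _) (b m)) ≤ mnorm y + n * n * θ :=
      mnorm_le_add_of_forall_norm_sub_le _ _ fun i j => (hz' i j).le
    refine h2.trans (add_le_add ?_ le_rfl)
    refine (ha m n z).trans (mul_le_mul_of_nonneg_left ?_ (hκ0 m))
    exact (hb m n z).trans (mul_le_mul_of_nonneg_left h3 (hκ0 m))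
  -- First `m → ∞` with `θ` fixed, which removes `κ m`; then `θ → 0`.
  have key' : ∀ θ : ℝ, 0 < θ → mnorm x ≤ (mnorm y + n * n * θ) + n * n * θ := by
    intro θ hθ
    have h1 : Filter.Tendsto (fun m => κ m * (κ m * (mnorm y + n * n * θ)) + n * n * θ)
        Filter.atTop (𝓝 (1 * (1 * (mnorm y + n * n * θ)) + n * n * θ)) :=
      (hκ.mul (hκ.mul_const _)).add_const _
    rw [one_mul, one_mul] at h1
    exact ge_of_tendsto h1 (key θ hθ)
  refine le_of_forall_pos_le_add fun e he => ?_
  have h2 := key' (e / (2 * (n * n + 1))) (by positivity)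
  have h3 : (n : ℝ) * n * (e / (2 * (n * n + 1))) ≤ e / 2 := by
    rw [mul_div_assoc', div_le_div_iff₀ (by positivity) (by norm_num)]
    nlinarith
  linarith

/-- A sequence of pairs of almost isometric embeddings in `X` and `Y`, coherent up to small errors
and with asymptotically dense ranges, determines a completely isometric isomorphism. -/
theorem exists_isometry_of_sequence [CompleteSpace X] [CompleteSpace Y] {c : ℝ} (hc : 0 ≤ c)
    (hc' : c ≤ 1 / 4) (κ : ℕ → ℝ) (hκ : Filter.Tendsto κ Filter.atTop (𝓝 1))
    (hκ0 : ∀ m, 0 ≤ κ m) (L : ℕ → FDOpSpace.{u})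
    (a : ∀ m, (L m).carrier →ₗ[ℂ] X) (b : ∀ m, (L m).carrier →ₗ[ℂ] Y)
    (ha : ∀ m, IsCbEmb (κ m) (a m)) (hb : ∀ m, IsCbEmb (κ m) (b m))
    (j : ∀ m, (L m).carrier →ₗ[ℂ] (L (m + 1)).carrier)
    (hja : ∀ m z, ‖a (m + 1) (j m z) - a m z‖ ≤ c / 2 ^ m * ‖a m z‖)
    (hjb : ∀ m z, ‖b (m + 1) (j m z) - b m z‖ ≤ c / 2 ^ m * ‖b m z‖)
    (hda : ∀ (x : X) (θ : ℝ) (N : ℕ), 0 < θ → ∃ m ≥ N, ∃ z, ‖a m z - x‖ < θ)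
    (hdb : ∀ (y : Y) (θ : ℝ) (N : ℕ), 0 < θ → ∃ m ≥ N, ∃ z, ‖b m z - y‖ < θ) :
    ∃ f : X ≃ₗ[ℂ] Y, IsCompletelyIsometric (f : X →ₗ[ℂ] Y) ∧
      ∀ z, ‖f (a 0 z) - b 0 z‖ ≤ 4 * c * (‖a 0 z‖ + ‖b 0 z‖) := by
  set G : Submodule ℂ (X × Y) := limitSubmodule (Z := X × Y) fun m => LinearMap.range ((a m).prod (b m)) with hG
  have hmem : ∀ p ∈ G, ∀ θ : ℝ, 0 < θ → ∀ᶠ m in Filter.atTop,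
      ∃ z, ‖a m z - p.1‖ < θ ∧ ‖b m z - p.2‖ < θ := by
    intro p hp θ hθ
    filter_upwards [hp θ hθ] with m hm
    obtain ⟨_, ⟨z, rfl⟩, hz⟩ := hm
    rw [Prod.norm_def, max_lt_iff] at hz
    exact ⟨z, hz⟩
  have hmat : ∀ (n : ℕ) (x : Matrix (Fin n) (Fin n) X) (y : Matrix (Fin n) (Fin n) Y),
      (∀ i j, (x i j, y i j) ∈ G) → mnorm x = mnorm y := by
    intro n x y hxy
    refine le_antisymm ?_ ?_
    · exact mnorm_le_of_approx κ hκ hκ0 L a b (fun m => (ha m).1) (fun m => (hb m).2) x y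
        fun i j θ hθ => hmem _ (hxy i j) θ hθ
    · refine mnorm_le_of_approx κ hκ hκ0 L b a (fun m => (hb m).1) (fun m => (ha m).2) y x
        fun i j θ hθ => ?_
      filter_upwards [hmem _ (hxy i j) θ hθ] with m hm
      exact hm.imp fun z hz => hz.symm
  have hnorm : ∀ p ∈ G, ‖p.1‖ = ‖p.2‖ := by
    intro p hp
    rw [← mnorm_one, ← mnorm_one]
    exact hmat 1 _ _ fun _ _ => hp
  have hlim : ∀ (m : ℕ) (z : (L m).carrier), ∃ p ∈ G,
      ‖p.1 - a m z‖ ≤ 4 * (c / 2 ^ m) * ‖a m z‖ ∧ ‖p.2 - b m z‖ ≤ 4 * (c / 2 ^ m) * ‖b m z‖ := by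
    intro m z
    -- Following `z` along the connecting maps, both images converge, so each stage lies near the
    -- limit graph with relative error `4 * (c / 2 ^ m)`. Density of late stages thus passes to the
    -- limit.
    let s : ∀ k : ℕ, (L (m + k)).carrier := fun k => Nat.rec z (fun k w => j (m + k) w) k
    have hs : ∀ k, s (k + 1) = j (m + k) (s k) := fun k => rfl
    have hcm : c / 2 ^ m ≤ 1 / 4 := (div_le_self hc (one_le_pow₀ (by norm_num))).trans hc'
    have hpow : ∀ k : ℕ, c / 2 ^ (m + k) = c / 2 ^ m / 2 ^ k := fun k => by
      rw [pow_add, div_div]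
    obtain ⟨x, hx, hx'⟩ := exists_tendsto_of_norm_sub_le (fun k => a (m + k) (s k))
      (c := c / 2 ^ m) (by positivity) hcm fun k => by
        rw [← hpow]; exact hja (m + k) (s k)
    obtain ⟨y, hy, hy'⟩ := exists_tendsto_of_norm_sub_le (fun k => b (m + k) (s k))
      (c := c / 2 ^ m) (by positivity) hcm fun k => by
        rw [← hpow]; exact hjb (m + k) (s k)
    refine ⟨(x, y), fun θ hθ => ?_, hx', hy'⟩
    obtain ⟨N, hN⟩ := ((Metric.tendsto_nhds.1 hx θ hθ).and
      (Metric.tendsto_nhds.1 hy θ hθ)).exists_forall_of_atTop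
    filter_upwards [Filter.eventually_ge_atTop (m + N)] with k hk
    obtain ⟨k, rfl⟩ := Nat.exists_eq_add_of_le (show m ≤ k by omega)
    obtain ⟨h1, h2⟩ := hN k (by omega)
    refine ⟨_, ⟨s k, rfl⟩, ?_⟩
    rw [dist_eq_norm] at h1 h2
    rw [Prod.norm_def, max_lt_iff]
    exact ⟨h1, h2⟩
  have hsmall : ∀ (r θ : ℝ), 0 ≤ r → 0 < θ → ∃ N : ℕ, ∀ m ≥ N, 4 * (c / 2 ^ m) * r < θ := by
    intro r θ hr hθ
    have h1 : Filter.Tendsto (fun m : ℕ => 4 * (c / 2 ^ m) * r) Filter.atTop (𝓝 0) := by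
      have h2 : Filter.Tendsto (fun m : ℕ => 4 * c * r * (1 / 2) ^ m) Filter.atTop
          (𝓝 (4 * c * r * 0)) :=
        (tendsto_pow_atTop_nhds_zero_of_lt_one (by norm_num) (by norm_num)).const_mul _
      rw [mul_zero] at h2
      refine h2.congr fun m => ?_
      rw [one_div, inv_pow]
      ring
    exact (h1.eventually (eventually_lt_nhds hθ)).exists_forall_of_atTop
  have hd₁ : ∀ (x : X) (θ : ℝ), 0 < θ → ∃ p ∈ G, ‖p.1 - x‖ < θ := by
    intro x θ hθ
    obtain ⟨N, hN⟩ := hsmall (‖x‖ + θ / 2) (θ / 2) (by positivity) (by positivity)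
    obtain ⟨m, hm, z, hz⟩ := hda x (θ / 2) N (by positivity)
    obtain ⟨p, hp, hp1, -⟩ := hlim m z
    refine ⟨p, hp, ?_⟩
    have h1 : ‖a m z‖ ≤ ‖x‖ + θ / 2 := by
      have := norm_add_le x (a m z - x)
      rw [add_sub_cancel] at this
      linarith
    have h2 : ‖p.1 - x‖ ≤ ‖p.1 - a m z‖ + ‖a m z - x‖ := by
      simpa using norm_add_le (p.1 - a m z) (a m z - x)
    have h3 : 4 * (c / 2 ^ m) * ‖a m z‖ ≤ 4 * (c / 2 ^ m) * (‖x‖ + θ / 2) := by gcongr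
    linarith [hN m hm]
  have hd₂ : ∀ (x : Y) (θ : ℝ), 0 < θ → ∃ p ∈ G, ‖p.2 - x‖ < θ := by
    intro x θ hθ
    obtain ⟨N, hN⟩ := hsmall (‖x‖ + θ / 2) (θ / 2) (by positivity) (by positivity)
    obtain ⟨m, hm, z, hz⟩ := hdb x (θ / 2) N (by positivity)
    obtain ⟨p, hp, -, hp1⟩ := hlim m z
    refine ⟨p, hp, ?_⟩
    have h1 : ‖b m z‖ ≤ ‖x‖ + θ / 2 := by
      have := norm_add_le x (b m z - x)
      rw [add_sub_cancel] at this
      linarith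
    have h2 : ‖p.2 - x‖ ≤ ‖p.2 - b m z‖ + ‖b m z - x‖ := by
      simpa using norm_add_le (p.2 - b m z) (b m z - x)
    have h3 : 4 * (c / 2 ^ m) * ‖b m z‖ ≤ 4 * (c / 2 ^ m) * (‖x‖ + θ / 2) := by gcongr
    linarith [hN m hm]
  obtain ⟨f, hf⟩ := exists_linearEquiv_of_graph (X := X) (Y := Y) G (isClosed_limitSubmodule _) hnorm hd₁ hd₂
  refine ⟨f, fun n A => ?_, fun z => ?_⟩
  · rw [matNorm_eq_ofReal, matNorm_eq_ofReal, hmat n A (A.map f) fun i j => hf (A i j)]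
    rfl
  · obtain ⟨p, hp, h1, h2⟩ := hlim 0 z
    -- The difference of two points of the graph is in the graph, which moves the error from `Y` to
    -- `X`.
    have h3 := hnorm _ (G.sub_mem (hf (a 0 z)) hp)
    simp only [Prod.fst_sub, Prod.snd_sub] at h3
    have h4 : ‖f (a 0 z) - b 0 z‖ ≤ ‖f (a 0 z) - p.2‖ + ‖p.2 - b 0 z‖ := by
      simpa using norm_add_le (f (a 0 z) - p.2) (p.2 - b 0 z)
    rw [← h3] at h4
    have h5 : ‖a 0 z - p.1‖ = ‖p.1 - a 0 z‖ := norm_sub_rev _ _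
    simp only [pow_zero, div_one] at h1 h2
    linarith

end Limit

/-! ### The back-and-forth and the embedding of a given range. -/

section Isomorphism

variable {𝓔 : Set FDOpSpace.{u}} {δ : ℝ → ℝ}
variable {H : Type u} [NormedAddCommGroup H] [InnerProductSpace ℂ H]
variable {K : Type u} [NormedAddCommGroup K] [InnerProductSpace ℂ K]
variable {X : Submodule ℂ (H →L[ℂ] H)} {Y : Submodule ℂ (K →L[ℂ] K)}

/-- A separable space has a dense sequence whose values are all taken infinitely often. -/
theorem exists_recurrent_denseSeq {Z : Type*} [NormedAddCommGroup Z]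
    [TopologicalSpace.SeparableSpace Z] :
    ∃ d : ℕ → Z, ∀ (x : Z) (θ : ℝ) (N : ℕ), 0 < θ → ∃ m ≥ N, ‖d m - x‖ < θ := by
  refine ⟨fun m => TopologicalSpace.denseSeq Z m.unpair.1, fun x θ N hθ => ?_⟩
  obtain ⟨k, hk⟩ := (TopologicalSpace.denseRange_denseSeq Z).exists_dist_lt x hθ
  refine ⟨Nat.pair k N, Nat.right_le_pair k N, ?_⟩
  dsimp only
  rw [Nat.unpair_pair]
  rwa [dist_comm, dist_eq_norm] at hk

theorem IsGurariiSpace.exists_recurrent_denseSeq (hX : IsGurariiSpace 𝓔 X) :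
    ∃ d : ℕ → X, ∀ (x : X) (θ : ℝ) (N : ℕ), 0 < θ → ∃ m ≥ N, ‖d m - x‖ < θ :=
  have : TopologicalSpace.SeparableSpace X := hX.separable.separableSpace
  OpSpace.exists_recurrent_denseSeq (Z := X)

/-- A pair of maps from a finite dimensional operator space to `X` and `Y`. -/
structure PairOfMaps (X : Submodule ℂ (H →L[ℂ] H)) (Y : Submodule ℂ (K →L[ℂ] K)) where
  /-- the domain -/
  L : FDOpSpace.{u}
  /-- the map to `X` -/
  a : L.carrier →ₗ[ℂ] X
  /-- the map to `Y` -/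
  b : L.carrier →ₗ[ℂ] Y

/-- The back-and-forth argument: the partial map between Gurarii spaces given by two almost
isometric embeddings of a member of `𝓔` is close to a completely isometric isomorphism. -/
theorem exists_isometry_near [CompleteSpace H] [CompleteSpace K]
    (h𝓔 : IsPerturbativeGurariiClass 𝓔 δ) (hX : IsGurariiSpace 𝓔 X) (hY : IsGurariiSpace 𝓔 Y)
    {c : ℝ} (hc : 0 < c) :
    ∃ κ : ℝ, 1 < κ ∧ ∀ L ∈ 𝓔, ∀ (a : L.carrier →ₗ[ℂ] X) (b : L.carrier →ₗ[ℂ] Y),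
      IsCbEmb κ a → IsCbEmb κ b → ∃ f : X ≃ₗ[ℂ] Y, IsCompletelyIsometric (f : X →ₗ[ℂ] Y) ∧
        ∀ z, ‖f (a z) - b z‖ ≤ c * ‖z‖ := by
  -- `1 / 4` is needed for convergence; `c / 16` because the final error is `4 * c₀ * (‖a z‖ + ‖b
  -- z‖)` with both norms at most `2 * ‖z‖`.
  set c₀ : ℝ := min (1 / 4) (c / 16) with hc₀
  have hc₀0 : 0 < c₀ := lt_min (by norm_num) (by positivity)
  have hτ : ∀ m : ℕ, 0 < c₀ / 2 ^ m := fun m => by positivity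
  choose k₁ hk₁ hstep₁ using fun m => exists_enlargement h𝓔 hX.gurarii hX.locallyEmbeds hY.gurarii
    hY.locallyEmbeds (hτ m)
  choose k₂ hk₂ hstep₂ using fun m => exists_enlargement h𝓔 hY.gurarii hY.locallyEmbeds hX.gurarii
    hX.locallyEmbeds (hτ m)
  set κ : ℕ → ℝ := fun m => min (min (k₁ m) (k₂ m)) (1 + 1 / ((m : ℝ) + 1)) with hκ
  have hκ1 : ∀ m, 1 < κ m := fun m =>
    lt_min (lt_min (hk₁ m) (hk₂ m)) (lt_add_of_pos_right _ (by positivity))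
  have hκlim : Filter.Tendsto κ Filter.atTop (𝓝 1) := by
    have h1 : Filter.Tendsto (fun m : ℕ => 1 + 1 / ((m : ℝ) + 1)) Filter.atTop (𝓝 (1 + 0)) :=
      tendsto_one_div_add_atTop_nhds_zero_nat.const_add 1
    rw [add_zero] at h1
    exact tendsto_of_tendsto_of_tendsto_of_le_of_le tendsto_const_nhds h1 (fun m => (hκ1 m).le)
      fun m => min_le_right _ _
  have hκk₁ : ∀ m, κ m ≤ k₁ m := fun m => (min_le_left _ _).trans (min_le_left _ _)
  have hκk₂ : ∀ m, κ m ≤ k₂ m := fun m => (min_le_left _ _).trans (min_le_right _ _)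
  have hκ0 : κ 0 ≤ 2 := (min_le_right _ _).trans (by norm_num)
  obtain ⟨x, hx⟩ := hX.exists_recurrent_denseSeq
  obtain ⟨y, hy⟩ := hY.exists_recurrent_denseSeq
  refine ⟨κ 0, hκ1 0, fun L hL a b ha hb => ?_⟩
  -- Even steps absorb a point of `X` and odd steps a point of `Y`, with the roles exchanged.
  -- Captured points may drift later, so the dense sequences must return near every point infinitely
  -- often.
  obtain ⟨s, hs0, hs⟩ := exists_sequence (α := PairOfMaps X Y)
    (fun m s => s.L ∈ 𝓔 ∧ IsCbEmb (κ m) s.a ∧ IsCbEmb (κ m) s.b)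
    (fun m s s' => ∃ j : s.L.carrier →ₗ[ℂ] s'.L.carrier,
      (∀ z, ‖s'.a (j z) - s.a z‖ ≤ c₀ / 2 ^ m * ‖s.a z‖) ∧
      (∀ z, ‖s'.b (j z) - s.b z‖ ≤ c₀ / 2 ^ m * ‖s.b z‖) ∧
      (Even m → x (m / 2) ∈ LinearMap.range s'.a) ∧ (Odd m → y (m / 2) ∈ LinearMap.range s'.b))
    ⟨L, a, b⟩ ⟨hL, ha, hb⟩ (by
      rintro m s ⟨hsL, hsa, hsb⟩
      rcases Nat.even_or_odd m with hm | hm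
      · obtain ⟨L', hL', a', b', j, ha', hb', hja, hjb, hxa⟩ := hstep₁ m s.L hsL s.a s.b
          (hsa.mono (hκk₁ m)) (hsb.mono (hκk₁ m)) (x (m / 2)) (κ (m + 1)) (hκ1 _)
        refine ⟨⟨L', a', b'⟩, ⟨hL', ha', hb'⟩, j, fun z => ?_, hjb, fun _ => hxa,
          fun h => absurd hm (Nat.not_even_iff_odd.2 h)⟩
        have h1 : a' (j z) = s.a z := LinearMap.congr_fun hja z
        have h2 : ‖a' (j z) - s.a z‖ = 0 := by rw [h1, sub_self]; exact norm_zero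
        rw [h2]
        exact mul_nonneg (hτ m).le (norm_nonneg _)
      · obtain ⟨L', hL', b', a', j, hb', ha', hjb, hja, hyb⟩ := hstep₂ m s.L hsL s.b s.a
          (hsb.mono (hκk₂ m)) (hsa.mono (hκk₂ m)) (y (m / 2)) (κ (m + 1)) (hκ1 _)
        refine ⟨⟨L', a', b'⟩, ⟨hL', ha', hb'⟩, j, hja, fun z => ?_,
          fun h => absurd h (Nat.not_even_iff_odd.2 hm), fun _ => hyb⟩
        have h1 : b' (j z) = s.b z := LinearMap.congr_fun hjb z
        have h2 : ‖b' (j z) - s.b z‖ = 0 := by rw [h1, sub_self]; exact norm_zero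
        rw [h2]
        exact mul_nonneg (hτ m).le (norm_nonneg _))
  choose j hja hjb hjx hjy using fun m => (hs m).2
  have : CompleteSpace X := hX.closed.completeSpace_coe
  have : CompleteSpace Y := hY.closed.completeSpace_coe
  obtain ⟨f, hf, hf'⟩ := exists_isometry_of_sequence hc₀0.le (min_le_left _ _) κ hκlim
    (fun m => zero_le_one.trans (hκ1 m).le) (fun m => (s m).L) (fun m => (s m).a)
    (fun m => (s m).b) (fun m => (hs m).1.2.1) (fun m => (hs m).1.2.2) j hja hjb
    (fun p θ N hθ => by
      obtain ⟨m, hm, hmp⟩ := hx p θ N hθ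
      obtain ⟨z, hz⟩ := hjx (2 * m) (even_two_mul m)
      rw [Nat.mul_div_cancel_left m two_pos] at hz
      refine ⟨2 * m + 1, by omega, z, ?_⟩
      rw [hz]
      exact hmp)
    (fun p θ N hθ => by
      obtain ⟨m, hm, hmp⟩ := hy p θ N hθ
      obtain ⟨z, hz⟩ := hjy (2 * m + 1) (odd_two_mul_add_one m)
      rw [show (2 * m + 1) / 2 = m by omega] at hz
      refine ⟨2 * m + 1 + 1, by omega, z, ?_⟩
      rw [hz]
      exact hmp)
  refine ⟨f, hf, ?_⟩
  rw [hs0] at hf'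
  intro z
  have h1 : ‖a z‖ ≤ 2 * ‖z‖ := (ha.mono hκ0).1.norm_le z
  have h2 : ‖b z‖ ≤ 2 * ‖z‖ := (hb.mono hκ0).1.norm_le z
  calc ‖f (a z) - b z‖ ≤ 4 * c₀ * (‖a z‖ + ‖b z‖) := hf' z
    _ ≤ 4 * (c / 16) * (2 * ‖z‖ + 2 * ‖z‖) := by
      gcongr
      exact min_le_right _ _
    _ = c * ‖z‖ := by ring

/-- An embedding in `Y` of a member of `𝓔` contained in `X`, which becomes an `η`-embedding after
almost isometric embeddings of its range in members of `𝓔`, is almost `δ η`-close to the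
restriction of a completely isometric isomorphism. -/
theorem exists_isometry_near_embedding [CompleteSpace H] [CompleteSpace K]
    (h𝓔 : IsPerturbativeGurariiClass 𝓔 δ) (hX : IsGurariiSpace 𝓔 X) (hY : IsGurariiSpace 𝓔 Y)
    {E : FDOpSpace.{u}} (hE : E ∈ 𝓔) {a : E.carrier →ₗ[ℂ] X} (ha : IsCbEmb 1 a)
    (f₀ : E.carrier →ₗ[ℂ] Y) {η : ℝ} (hη : 0 < η)
    (hw : ∀ κ : ℝ, 1 < κ → ∃ L ∈ 𝓔, ∃ w : rangeIn f₀ →ₗ[ℂ] L.carrier, IsCbEmb κ w ∧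
      IsCbEmb (1 + η) (w ∘ₗ toRange f₀)) {δ' : ℝ} (hδ' : 0 < δ') :
    ∃ f : X ≃ₗ[ℂ] Y, IsCompletelyIsometric (f : X →ₗ[ℂ] Y) ∧
      cbNorm ((f : X →ₗ[ℂ] Y) ∘ₗ a - f₀) ≤ ENNReal.ofReal (8 * δ η + δ') := by
  -- `C` depends on `E` alone, so it can be fixed before `κ`, `g` and `f`; it turns the norm error
  -- of the isomorphism into a cb error of `δ' / 2`.
  obtain ⟨C, hC, hCE⟩ := exists_cbLE_of_norm_le E.carrier
  obtain ⟨κ, hκ, hiso⟩ := exists_isometry_near h𝓔 hX hY (c := δ' / (2 * C)) (by positivity)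
  obtain ⟨g, hg, hgf₀⟩ := h𝓔.perturbative.exists_near hY.gurarii hE f₀ hη hw hκ
    (ρ := δ' / 2) (by positivity)
  obtain ⟨f, hf, hfa⟩ := hiso E hE a g (ha.mono hκ.le) hg
  refine ⟨f, hf, ?_⟩
  have hδη := h𝓔.perturbative.pos η hη
  rw [cbNorm_le_ofReal_iff (by positivity)]
  have h1 : CbLE ((f : X →ₗ[ℂ] Y) ∘ₗ a - g) (C * (δ' / (2 * C))) :=
    hCE _ _ (by positivity) hfa
  have h2 := h1.add hgf₀
  have h4 : (f : X →ₗ[ℂ] Y) ∘ₗ a - g + (g - f₀) = (f : X →ₗ[ℂ] Y) ∘ₗ a - f₀ := by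
    ext1 z
    simp
  rw [h4] at h2
  refine h2.mono ?_
  have h3 : C * (δ' / (2 * C)) = δ' / 2 := by field_simp
  rw [h3]
  linarith

/-- The Gurarii property starting from the zero subspace. It supplies an initial stage when no
partial map is given. -/
theorem exists_isCbEmb_of_member {L : FDOpSpace.{u}} (hL : L ∈ 𝓔) (hX : HasGurariiProperty 𝓔 X)
    {κ : ℝ} (hκ : 1 < κ) : ∃ a : L.carrier →ₗ[ℂ] X, IsCbEmb κ a := by
  obtain ⟨a, -, ha⟩ := hX.exists_extension hL (S := ⊥) bot_le (f := 0) (κ := 1) le_rfl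
    ⟨cbLE_of_subsingleton _ _, cbGE_of_subsingleton _ _⟩ (by rwa [one_pow])
  exact ⟨a, ha⟩

/-- If one of the two bounds of an `ε`-embedding is strict, then a normalized almost isometric
embedding of its range in a member of `𝓔` yields an `ε`-embedding. -/
theorem exists_map_range_of_mul_lt (h𝓔 : IsClass 𝓔) (hY : LocallyEmbeds 𝓔 Y)
    {V : Submodule ℂ (H →L[ℂ] H)} [FiniteDimensional ℂ V] {f : V →ₗ[ℂ] Y} {ε : ℝ} (hε : 0 < ε)
    (hf : IsEpsEmbedding ε f) (hlt : cbNorm f * invCbNorm f < ENNReal.ofReal ((1 + ε) ^ 2))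
    {κ : ℝ} (hκ : 1 < κ) : ∃ L ∈ 𝓔, ∃ w : rangeIn f →ₗ[ℂ] L.carrier, IsCbEmb κ w ∧
      IsCbEmb (1 + ε) (w ∘ₗ toRange f) := by
  have hf' := (isEpsEmbedding_iff hε).1 hf
  have hfd := finiteDimensional_rangeIn f
  have hcase : cbNorm f < ENNReal.ofReal (1 + ε) ∨ invCbNorm f < ENNReal.ofReal (1 + ε) := by
    by_contra! h
    refine hlt.not_ge ?_
    rw [pow_two, ENNReal.ofReal_mul (by linarith)]
    exact mul_le_mul' h.1 h.2
  -- A strict bound leaves room for a factor `t > 1`. The maximum with `1` keeps the denominator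
  -- positive.
  have hr : ∀ r : ℝ≥0∞, r < ENNReal.ofReal (1 + ε) →
      ∃ t : ℝ, 1 < t ∧ t ≤ κ ∧ t * r.toReal ≤ 1 + ε := by
    intro r hr
    have hr1 : max r.toReal 1 < 1 + ε :=
      max_lt ((ENNReal.lt_ofReal_iff_toReal_lt hr.ne_top).1 hr) (by linarith)
    have hr0 : 0 < max r.toReal 1 := lt_max_of_lt_right one_pos
    refine ⟨min κ ((1 + ε) / max r.toReal 1), lt_min hκ ((one_lt_div hr0).2 hr1),
      min_le_left _ _, ?_⟩
    calc _ ≤ (1 + ε) / max r.toReal 1 * max r.toReal 1 := by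
          gcongr
          · exact min_le_right _ _
          · exact le_max_left _ _
      _ = 1 + ε := div_mul_cancel₀ _ hr0.ne'
  rcases hcase with h | h
  · obtain ⟨t, ht1, htκ, ht⟩ := hr _ h
    obtain ⟨L, hL, w, hw1, hwt⟩ := hY.exists_map h𝓔 (rangeIn f) (rangeIn_le f) ht1
    have ht0 : 0 < t := by linarith
    -- Scaling by `t` moves the distortion of `w` from its inverse to `w` itself, where `f` has
    -- room. In the other case `w` already has it on the right side.
    have h1 : CbLE ((t : ℂ) • w) t := by simpa using hw1.smul ht0.le
    have h2 : CbGE ((t : ℂ) • w) 1 := by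
      have := hwt.smul ht0
      rwa [inv_mul_cancel₀ ht0.ne'] at this
    have h3 : CbLE (toRange f) (cbNorm f).toReal := fun n a => cbLE_toReal h.ne_top n a
    refine ⟨L, hL, (t : ℂ) • w, ⟨h1.mono htκ, h2.mono hκ.le⟩, (h1.comp h3 ht0.le).mono ht, ?_⟩
    have := h2.comp (isCbEmb_toRange hf').2 (by linarith)
    rwa [one_mul] at this
  · obtain ⟨t, ht1, htκ, ht⟩ := hr _ h
    obtain ⟨L, hL, w, hw1, hwt⟩ := hY.exists_map h𝓔 (rangeIn f) (rangeIn_le f) ht1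
    have h3 : CbGE (toRange f) (invCbNorm f).toReal := fun n a => cbGE_toReal h.ne_top n a
    refine ⟨L, hL, w, ⟨hw1.mono hκ.le, hwt.mono htκ⟩, ?_,
      (hwt.comp h3 ENNReal.toReal_nonneg).mono ht⟩
    have := hw1.comp (isCbEmb_toRange hf').1 zero_le_one
    rwa [one_mul] at this

/-- Seen as an `η`-embedding, `f` has both bounds strict, so the previous criterion applies. -/
theorem exists_map_range_of_lt (h𝓔 : IsClass 𝓔) (hY : LocallyEmbeds 𝓔 Y)
    {V : Submodule ℂ (H →L[ℂ] H)} [FiniteDimensional ℂ V] {f : V →ₗ[ℂ] Y} {ε η : ℝ} (hε : 0 < ε)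
    (hf : IsEpsEmbedding ε f) (hη : ε < η) {κ : ℝ} (hκ : 1 < κ) :
    ∃ L ∈ 𝓔, ∃ w : rangeIn f →ₗ[ℂ] L.carrier, IsCbEmb κ w ∧
      IsCbEmb (1 + η) (w ∘ₗ toRange f) := by
  have h1 : ENNReal.ofReal (1 + ε) ≤ ENNReal.ofReal (1 + η) :=
    ENNReal.ofReal_le_ofReal (by linarith)
  refine exists_map_range_of_mul_lt h𝓔 hY (hε.trans hη)
    ⟨hf.1, hf.2.1.trans h1, hf.2.2.trans h1⟩ ?_ hκ
  refine (mul_le_mul' hf.2.1 hf.2.2).trans_lt ?_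
  rw [← ENNReal.ofReal_mul (by linarith), ← pow_two, ENNReal.ofReal_lt_ofReal_iff (pow_pos (by linarith) 2)]
  gcongr

end Isomorphism

end OpSpace

end

open OpSpace in
theorem theorem5p7
    (𝓔 : Set FDOpSpace.{u}) (δ : ℝ → ℝ) (h𝓔 : IsPerturbativeGurariiClass 𝓔 δ)
    {H : Type u} [NormedAddCommGroup H] [InnerProductSpace ℂ H] [CompleteSpace H]
    {K : Type u} [NormedAddCommGroup K] [InnerProductSpace ℂ K] [CompleteSpace K]
    (X : Submodule ℂ (H →L[ℂ] H)) (Y : Submodule ℂ (K →L[ℂ] K))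
    (hX : IsGurariiSpace 𝓔 X) (hY : IsGurariiSpace 𝓔 Y) :
    (∀ ε : ℝ, 0 < ε →
      ∀ (E : Submodule ℂ (H →L[ℂ] H)) [FiniteDimensional ℂ E] (hE : E ≤ X),
      FDOpSpace.mk H E ∈ 𝓔 →
      ∀ f₀ : E →ₗ[ℂ] Y, IsEpsEmbedding ε f₀ →
      (∀ η : ℝ, ε < η → ∀ δ' : ℝ, 0 < δ' →
        ∃ f : X ≃ₗ[ℂ] Y, IsCompletelyIsometric (f : X →ₗ[ℂ] Y) ∧
          cbNorm ((f : X →ₗ[ℂ] Y) ∘ₗ Submodule.inclusion hE - f₀)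
            ≤ ENNReal.ofReal (8 * δ η + δ')) ∧
      ((cbNorm f₀ * invCbNorm f₀ < ENNReal.ofReal ((1 + ε) ^ 2) ∨
          IsSubspaceOfMember 𝓔 (rangeIn f₀) ∨
          UpperSemicontinuousWithinAt δ (Set.Ioi ε) ε) →
        ∀ δ' : ℝ, 0 < δ' →
        ∃ f : X ≃ₗ[ℂ] Y, IsCompletelyIsometric (f : X →ₗ[ℂ] Y) ∧
          cbNorm ((f : X →ₗ[ℂ] Y) ∘ₗ Submodule.inclusion hE - f₀)
            ≤ ENNReal.ofReal (8 * δ ε + δ'))) ∧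
    ∃ f : X ≃ₗ[ℂ] Y, IsCompletelyIsometric (f : X →ₗ[ℂ] Y) := by
  refine ⟨fun ε hε E _ hE hE𝓔 f₀ hf₀ => ?_, ?_⟩
  · have ha : ∀ η : ℝ, ε < η → ∀ δ' : ℝ, 0 < δ' →
        ∃ f : X ≃ₗ[ℂ] Y, IsCompletelyIsometric (f : X →ₗ[ℂ] Y) ∧
          cbNorm ((f : X →ₗ[ℂ] Y) ∘ₗ Submodule.inclusion hE - f₀)
            ≤ ENNReal.ofReal (8 * δ η + δ') := fun η hη δ' hδ' =>
      exists_isometry_near_embedding h𝓔 hX hY hE𝓔 (isCbEmb_inclusion hE) f₀ (hε.trans hη)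
        (fun _ => exists_map_range_of_lt h𝓔.isClass hY.locallyEmbeds hε hf₀ hη) hδ'
    refine ⟨ha, fun hcase δ' hδ' => ?_⟩
    rcases hcase with h | h | h
    · exact exists_isometry_near_embedding h𝓔 hX hY hE𝓔 (isCbEmb_inclusion hE) f₀ hε
        (fun _ => exists_map_range_of_mul_lt h𝓔.isClass hY.locallyEmbeds hε hf₀ h) hδ'
    · obtain ⟨L, hL, j, hj⟩ := h
      refine exists_isometry_near_embedding h𝓔 hX hY hE𝓔 (isCbEmb_inclusion hE) f₀ hε
        (fun κ hκ => ⟨L, hL, j, hj.isCbEmb.mono hκ.le, ?_⟩) hδ'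
      have := hj.isCbEmb.comp (isCbEmb_toRange ((isEpsEmbedding_iff hε).1 hf₀)) (by linarith)
        zero_le_one
      rwa [one_mul] at this
    -- Some `η > ε` has `δ η < δ ε + δ' / 16`; eight times this excess is `δ' / 2`, and the other
    -- half goes to the bound at `η`.
    · have h1 := h (δ ε + δ' / 16) (by linarith)
      obtain ⟨η, hη, hη' : ε < η⟩ := (h1.and self_mem_nhdsWithin).exists
      obtain ⟨f, hf, hf'⟩ := ha η hη' (δ' / 2) (by linarith)
      exact ⟨f, hf, hf'.trans (ENNReal.ofReal_le_ofReal (by linarith))⟩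
  · obtain ⟨L, hL, -⟩ := h𝓔.isClass.nontrivial
    obtain ⟨κ, hκ, h⟩ := exists_isometry_near h𝓔 hX hY one_pos
    obtain ⟨a, ha⟩ := exists_isCbEmb_of_member hL hX.gurarii hκ
    obtain ⟨b, hb⟩ := exists_isCbEmb_of_member hL hY.gurarii hκ
    obtain ⟨f, hf, -⟩ := h L hL a b ha hb
    exact ⟨f, hf⟩
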